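/- Let $k$ be an algebraically closed field. Let $\Gamma$ be a Brauer graph: a finite connected graph with at least one edge (loops and multiple edges allowed) in which each edge has two ends, called germs, each germ attached to a vertex, with a cyclic ordering of the germs around each vertex and an integer $e(\nu)\ge 1$, the multiplicity, at each vertex $\nu$. The valency of $\nu$ is the number of germs attached to $\nu$. Assume that $e(\nu)=1$ for every vertex $\nu$, and that $\Gamma$ is not a single edge joining two distinct vertices. The Brauer graph algebra of $\Gamma$ is $\Lambda=kQ_\Lambda/I_\Lambda$, defined as follows (paths are composed from left to right). The vertices of $Q_\Lambda$ are the edges of $\Gamma$. Each germ $h$ attached to a vertex of valency at least $2$ gives one arrow, from the edge of $h$ to the edge of the direct successor of $h$ in the cyclic ordering; there are no other arrows. For each vertex $\nu$ of valency at least $2$, the arrows given by the germs at $\nu$ form an oriented cycle of $Q_\Lambda$, the vertex cycle of $\nu$; for a germ $h$ at $\nu$ let $C_h$ be the path that goes once around this cycle, starting with the arrow $\alpha_h$ of $h$. The two-sided ideal $I_\Lambda$ is generated by: 1. $C_h-C_{h'}$, for each edge whose two germs $h,h'$ are both attached to vertices of valency at least $2$; 2. $C_h\alpha_h$, for each edge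 with germs $h,h'$ where $h'$ is attached to a vertex of valency one; 3. $\alpha\beta$, for all arrows $\alpha,\beta$ such that $\alpha$ ends where $\beta$ starts but $\beta$ is not the arrow that follows $\alpha$ in the vertex cycle of $\alpha$. Let $D$ be a cutting set, that is, a set of arrows of $Q_\Lambda$ that contains exactly one arrow of every vertex cycle, and let $A=kQ_\Lambda/J_\Lambda$ be the corresponding admissible cut, where $J_\Lambda$ is the two-sided ideal generated by $I_\Lambda\cup D$. Then: (a) $A$ is gentle, that is, $A$ is a finite dimensional algebra Morita equivalent to $kQ/I$ for some finite connected quiver $Q$ and some admissible ideal $I$ of $kQ$ such that: (S1) at most two arrows start and at most two arrows end at each vertex of $Q$; (S2) for each arrow $\alpha$ there is at most one arrow $\beta$ such that $\alpha\beta$ is a path not in $I$, and at most one arrow $\gamma$ such that $\gamma\alpha$ is a path not in $I$; (S3) $I$ is generated by paths of length two; (S4) for each arrow $\alpha$ there is at most one arrow $\delta$ such that $\alpha\delta$ is a path in $I$, and at most one arrow $\varepsilon$ such that $\varepsilon\alpha$ is a path in $I$. (b) The trivial extension $T(A)=A\ltimes D(A)$, where $D(A)=\operatorname{Hom}_k(A,k)$,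 that is, $A\oplus D(A)$ with the multiplication $(a,f)(b,g)=(ab,\,ag+fb)$, is isomorphic to $\Lambda$ as a $k$-algebra. -/

import Mathlib

universe u v w

/-! ### Path algebras -/

/-- All paths of a quiver (with their source and target), including the trivial paths. -/
abbrev QuiverPath (Q : Type u) [Quiver.{v} Q] : Type (max u v) :=
  Σ a b : Q, Quiver.Path a b

/-- The path algebra `kQ`: the vector space with basis the paths of `Q`. Paths are composed from
left to right: `p * q` is first `p`, then `q`. -/
def PathAlgebra (k : Type w) (Q : Type u) [Field k] [Quiver.{v} Q] : Type (max u v w) :=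
  QuiverPath Q →₀ k

namespace PathAlgebra

variable (k : Type w) {Q : Type u} [Field k] [Quiver.{v} Q]

noncomputable instance : AddCommGroup (PathAlgebra k Q) :=
  inferInstanceAs (AddCommGroup (QuiverPath Q →₀ k))

noncomputable instance : Module k (PathAlgebra k Q) :=
  inferInstanceAs (Module k (QuiverPath Q →₀ k))

/-- The basis element of `kQ` given by a path. -/
noncomputable def ofPath {a b : Q} (p : Quiver.Path a b) : PathAlgebra k Q :=
  (Finsupp.single (⟨a, b, p⟩ : QuiverPath Q) (1 : k) : QuiverPath Q →₀ k)

open Classical in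
/-- The product of two paths: their concatenation if the first ends where the second starts, and
zero otherwise. -/
noncomputable def pathMul (p q : QuiverPath Q) : PathAlgebra k Q :=
  if h : q.1 = p.2.1 then ofPath k (p.2.2.comp (q.2.2.cast h rfl)) else 0

/-- The bilinear extension of the product of paths. -/
noncomputable def mulLin : PathAlgebra k Q →ₗ[k] PathAlgebra k Q →ₗ[k] PathAlgebra k Q :=
  Finsupp.linearCombination k (fun p : QuiverPath Q =>
    (Finsupp.linearCombination k (fun q : QuiverPath Q => pathMul k p q) :
      PathAlgebra k Q →ₗ[k] PathAlgebra k Q))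

noncomputable instance : Mul (PathAlgebra k Q) := ⟨fun x y => mulLin k x y⟩

noncomputable instance [Fintype Q] : One (PathAlgebra k Q) :=
  ⟨∑ a : Q, ofPath k (Quiver.Path.nil : Quiver.Path a a)⟩

theorem mul_def (x y : PathAlgebra k Q) : x * y = mulLin k x y := rfl

theorem one_def [Fintype Q] :
    (1 : PathAlgebra k Q) = ∑ a : Q, ofPath k (Quiver.Path.nil : Quiver.Path a a) := rfl

theorem mulLin_ofPath {a b c d : Q} (p : Quiver.Path a b) (q : Quiver.Path c d) :
    mulLin k (ofPath k p) (ofPath k q) = pathMul k ⟨a, b, p⟩ ⟨c, d, q⟩ := by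
  have h1 : mulLin k (ofPath k p) =
      (Finsupp.linearCombination k (fun q : QuiverPath Q => pathMul k ⟨a, b, p⟩ q) :
        PathAlgebra k Q →ₗ[k] PathAlgebra k Q) := by
    unfold mulLin ofPath
    exact (Finsupp.linearCombination_single k 1 _).trans (one_smul k _)
  rw [h1]
  exact (Finsupp.linearCombination_single k 1 _).trans (one_smul k _)

theorem ofPath_mul_ofPath {a b c : Q} (p : Quiver.Path a b) (q : Quiver.Path b c) :
    ofPath k p * ofPath k q = ofPath k (p.comp q) := by
  rw [mul_def, mulLin_ofPath]
  simp [pathMul]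

theorem ofPath_mul_ofPath_of_ne {a b c d : Q} (p : Quiver.Path a b) (q : Quiver.Path c d)
    (h : b ≠ c) : ofPath k p * ofPath k q = 0 := by
  rw [mul_def, mulLin_ofPath]
  simp [pathMul, h.symm]

theorem hom_ext {M : Type*} [AddCommGroup M] [Module k M] {f g : PathAlgebra k Q →ₗ[k] M}
    (h : ∀ {a b : Q} (p : Quiver.Path a b), f (ofPath k p) = g (ofPath k p)) : f = g :=
  Finsupp.lhom_ext' fun ⟨_, _, p⟩ => LinearMap.ext_ring (h p)

theorem mulLin_assoc (x y z : PathAlgebra k Q) :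
    mulLin k (mulLin k x y) z = mulLin k x (mulLin k y z) := by
  let F : PathAlgebra k Q →ₗ[k] PathAlgebra k Q →ₗ[k] PathAlgebra k Q →ₗ[k] PathAlgebra k Q :=
    (mulLin k).compr₂ (mulLin k)
  let G : PathAlgebra k Q →ₗ[k] PathAlgebra k Q →ₗ[k] PathAlgebra k Q →ₗ[k] PathAlgebra k Q :=
    LinearMap.llcomp k (PathAlgebra k Q) (PathAlgebra k Q →ₗ[k] PathAlgebra k Q)
      (PathAlgebra k Q →ₗ[k] PathAlgebra k Q) |>.flip (mulLin k) |>.comp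
      ((LinearMap.llcomp k (PathAlgebra k Q) (PathAlgebra k Q) (PathAlgebra k Q)).comp (mulLin k))
  have hFG : F = G := by
    refine hom_ext k fun {a b} p => hom_ext k fun {c d} q => hom_ext k fun {e f} r => ?_
    change ofPath k p * ofPath k q * ofPath k r = ofPath k p * (ofPath k q * ofPath k r)
    have h0 : ∀ x : PathAlgebra k Q, (0 : PathAlgebra k Q) * x = 0 := fun x => by
      rw [mul_def, map_zero, LinearMap.zero_apply]
    have h0' : ∀ x : PathAlgebra k Q, x * (0 : PathAlgebra k Q) = 0 := fun x => by
      rw [mul_def, map_zero]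
    by_cases hbc : b = c
    · subst hbc
      by_cases hde : d = e
      · subst hde
        simp only [ofPath_mul_ofPath, Quiver.Path.comp_assoc]
      · rw [ofPath_mul_ofPath, ofPath_mul_ofPath_of_ne k _ _ hde,
          ofPath_mul_ofPath_of_ne k _ _ hde, h0']
    · by_cases hde : d = e
      · subst hde
        rw [ofPath_mul_ofPath, ofPath_mul_ofPath_of_ne k _ _ hbc,
          ofPath_mul_ofPath_of_ne k _ _ hbc, h0]
      · rw [ofPath_mul_ofPath_of_ne k _ _ hbc, ofPath_mul_ofPath_of_ne k _ _ hde, h0, h0']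
  exact congrArg (fun H => H x y z) hFG

theorem one_mulLin [Fintype Q] (x : PathAlgebra k Q) : mulLin k 1 x = x := by
  have h : mulLin k (1 : PathAlgebra k Q) = LinearMap.id := by
    classical
    refine hom_ext k fun {a b} p => ?_
    rw [one_def, map_sum, LinearMap.sum_apply, Finset.sum_eq_single a]
    · rw [← mul_def, ofPath_mul_ofPath, Quiver.Path.nil_comp, LinearMap.id_apply]
    · intro c _ hc
      rw [← mul_def, ofPath_mul_ofPath_of_ne k _ _ hc]
    · simp
  rw [h, LinearMap.id_apply]

theorem mulLin_one [Fintype Q] (x : PathAlgebra k Q) : mulLin k x 1 = x := by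
  have h : (mulLin k).flip (1 : PathAlgebra k Q) = LinearMap.id := by
    classical
    refine hom_ext k fun {a b} p => ?_
    rw [LinearMap.flip_apply, one_def, map_sum, Finset.sum_eq_single b]
    · rw [← mul_def, ofPath_mul_ofPath, Quiver.Path.comp_nil, LinearMap.id_apply]
    · intro c _ hc
      rw [← mul_def, ofPath_mul_ofPath_of_ne k _ _ hc.symm]
    · simp
  have := congrArg (fun H => H x) h
  exact this

noncomputable instance [Fintype Q] : Ring (PathAlgebra k Q) where
  __ := (inferInstance : AddCommGroup (PathAlgebra k Q))
  mul := (· * ·)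
  one := 1
  left_distrib x y z := map_add (mulLin k x) y z
  right_distrib x y z := by
    change mulLin k (x + y) z = mulLin k x z + mulLin k y z
    rw [map_add, LinearMap.add_apply]
  zero_mul x := by
    change mulLin k 0 x = 0
    rw [map_zero, LinearMap.zero_apply]
  mul_zero x := map_zero (mulLin k x)
  mul_assoc := mulLin_assoc k
  one_mul := one_mulLin k
  mul_one := mulLin_one k

noncomputable instance [Fintype Q] : Algebra k (PathAlgebra k Q) :=
  Algebra.ofModule
    (fun r x y => by
      change mulLin k (r • x) y = r • mulLin k x y
      rw [map_smul, LinearMap.smul_apply])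
    (fun r x y => map_smul (mulLin k x) r y)

/-- The basis element of `kQ` given by an arrow. -/
noncomputable def ofArrow {a b : Q} (α : a ⟶ b) : PathAlgebra k Q :=
  ofPath k α.toPath

/-- The span of the paths of length at least `m`; this is the `m`-th power of the arrow ideal. -/
noncomputable def lengthGE (Q : Type u) [Quiver.{v} Q] (m : ℕ) : Submodule k (PathAlgebra k Q) :=
  Submodule.span k {x | ∃ (a b : Q) (p : Quiver.Path a b), m ≤ p.length ∧ x = ofPath k p}

end PathAlgebra

/-- The quotient of a `k`-algebra by a two-sided ideal. -/
abbrev QuotientAlgebra {R : Type*} [Ring R] (I : TwoSidedIdeal R) : Type _ :=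
  R ⧸ TwoSidedIdeal.asIdeal I

/-! ### Gentle algebras -/

section Gentle

/-- A quiver is connected if it is nonempty and its underlying undirected graph is connected. -/
def QuiverConnected (Q : Type u) [Quiver.{v} Q] : Prop :=
  Nonempty Q ∧ ∀ a b : Q, Relation.EqvGen (fun a b : Q => Nonempty (a ⟶ b)) a b

variable {k : Type w} {Q : Type u} [Field k] [Quiver.{v} Q] [Fintype Q]

open PathAlgebra

/-- An ideal of `kQ` is admissible if, for the arrow ideal `R`, one has `R ^ m ⊆ I ⊆ R ^ 2` for
some `m ≥ 2`. -/
def IsAdmissibleIdeal (I : TwoSidedIdeal (PathAlgebra k Q)) : Prop :=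
  (∀ x ∈ I, x ∈ lengthGE k Q 2) ∧ ∃ m : ℕ, 2 ≤ m ∧ ∀ x ∈ lengthGE k Q m, x ∈ I

/-- The conditions (S1), (S2), (S3), (S4) on a bound quiver. -/
structure IsGentlePair (I : TwoSidedIdeal (PathAlgebra k Q)) : Prop where
  /-- (S1) At most two arrows start at each vertex. -/
  card_out_le : ∀ a : Q, Nat.card (Σ b : Q, (a ⟶ b)) ≤ 2
  /-- (S1) At most two arrows end at each vertex. -/
  card_in_le : ∀ b : Q, Nat.card (Σ a : Q, (a ⟶ b)) ≤ 2
  /-- (S2) For each arrow `α` there is at most one arrow `β` with `αβ` a path not in `I`. -/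
  unique_notMem_right : ∀ {a b : Q} (α : a ⟶ b) (β β' : Σ c : Q, (b ⟶ c)),
    ofArrow k α * ofArrow k β.2 ∉ I → ofArrow k α * ofArrow k β'.2 ∉ I → β = β'
  /-- (S2) For each arrow `α` there is at most one arrow `γ` with `γα` a path not in `I`. -/
  unique_notMem_left : ∀ {b c : Q} (α : b ⟶ c) (γ γ' : Σ a : Q, (a ⟶ b)),
    ofArrow k γ.2 * ofArrow k α ∉ I → ofArrow k γ'.2 * ofArrow k α ∉ I → γ = γ'
  /-- (S3) `I` is generated by paths of length two. -/
  generated : ∃ P : Set (QuiverPath Q), (∀ p ∈ P, p.2.2.length = 2) ∧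
    I = TwoSidedIdeal.span ((fun p : QuiverPath Q => ofPath k p.2.2) '' P)
  /-- (S4) For each arrow `α` there is at most one arrow `δ` with `αδ` a path in `I`. -/
  unique_mem_right : ∀ {a b : Q} (α : a ⟶ b) (δ δ' : Σ c : Q, (b ⟶ c)),
    ofArrow k α * ofArrow k δ.2 ∈ I → ofArrow k α * ofArrow k δ'.2 ∈ I → δ = δ'
  /-- (S4) For each arrow `α` there is at most one arrow `ε` with `εα` a path in `I`. -/
  unique_mem_left : ∀ {b c : Q} (α : b ⟶ c) (ε ε' : Σ a : Q, (a ⟶ b)),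
    ofArrow k ε.2 * ofArrow k α ∈ I → ofArrow k ε'.2 * ofArrow k α ∈ I → ε = ε'

end Gentle

/-- A `k`-algebra is gentle if it is finite dimensional and Morita equivalent to `kQ/I` for a
finite connected quiver `Q` and an admissible ideal `I` satisfying (S1) to (S4). (The universe `u`
of the quiver is immaterial, since `Q` is finite.) -/
def IsGentle (k : Type w) [Field k] (A : Type v) [Ring A] [Algebra k A] : Prop :=
  Module.Finite k A ∧
  ∃ (Q : Type u) (_ : Quiver.{u} Q) (_ : Fintype Q) (_ : ∀ a b : Q, Finite (a ⟶ b))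
    (I : TwoSidedIdeal (PathAlgebra k Q)),
    QuiverConnected Q ∧ IsAdmissibleIdeal I ∧ IsGentlePair I ∧
      IsMoritaEquivalent k A (QuotientAlgebra I)

/-! ### Trivial extensions -/

/-- The `A`-`A`-bimodule `D(A) = Hom_k(A, k)`. -/
def DualBimodule (k : Type w) (A : Type v) [Field k] [Ring A] [Algebra k A] : Type (max v w) :=
  A →ₗ[k] k

namespace DualBimodule

variable {k : Type w} {A : Type v} [Field k] [Ring A] [Algebra k A]

noncomputable instance : AddCommGroup (DualBimodule k A) :=
  inferInstanceAs (AddCommGroup (A →ₗ[k] k))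

noncomputable instance : Module k (DualBimodule k A) :=
  inferInstanceAs (Module k (A →ₗ[k] k))

/-- An element of `D(A)` as a linear map. -/
abbrev lin (f : DualBimodule k A) : A →ₗ[k] k := f

/-- The left action `(a f)(x) = f (x a)`. -/
noncomputable instance : Module A (DualBimodule k A) where
  smul a f := LinearMap.comp f.lin (LinearMap.mulRight k a)
  one_smul f := LinearMap.ext fun x => congrArg f.lin (mul_one x)
  mul_smul a b f := LinearMap.ext fun x => congrArg f.lin (mul_assoc x a b).symm
  smul_zero _ := LinearMap.ext fun _ => rfl
  smul_add _ _ _ := LinearMap.ext fun _ => rfl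
  add_smul a b f := LinearMap.ext fun x =>
    (congrArg f.lin (mul_add x a b)).trans (map_add f.lin _ _)
  zero_smul f := LinearMap.ext fun x =>
    (congrArg f.lin (mul_zero x)).trans (map_zero f.lin)

/-- The right action `(f a)(x) = f (a x)`. -/
noncomputable instance : Module Aᵐᵒᵖ (DualBimodule k A) where
  smul a f := LinearMap.comp f.lin (LinearMap.mulLeft k a.unop)
  one_smul f := LinearMap.ext fun x => congrArg f.lin (one_mul x)
  mul_smul a b f := LinearMap.ext fun x =>
    congrArg f.lin (mul_assoc b.unop a.unop x)
  smul_zero _ := LinearMap.ext fun _ => rfl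
  smul_add _ _ _ := LinearMap.ext fun _ => rfl
  add_smul a b f := LinearMap.ext fun x =>
    (congrArg f.lin (add_mul a.unop b.unop x)).trans (map_add f.lin _ _)
  zero_smul f := LinearMap.ext fun x =>
    (congrArg f.lin (zero_mul x)).trans (map_zero f.lin)

instance : SMulCommClass A Aᵐᵒᵖ (DualBimodule k A) where
  smul_comm a b f := LinearMap.ext fun x =>
    congrArg f.lin (mul_assoc b.unop x a).symm

instance : IsScalarTower k A (DualBimodule k A) where
  smul_assoc c a f := LinearMap.ext fun x =>
    (congrArg f.lin (mul_smul_comm c x a)).trans (map_smul f.lin c _)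

instance : IsScalarTower k Aᵐᵒᵖ (DualBimodule k A) where
  smul_assoc c a f := LinearMap.ext fun x =>
    (congrArg f.lin (smul_mul_assoc c a.unop x)).trans (map_smul f.lin c _)

end DualBimodule

/-- The trivial extension `T(A) = A ⋉ D(A)`, with `(a, f) (b, g) = (ab, ag + fb)`. -/
abbrev TrivialExtension (k : Type w) (A : Type v) [Field k] [Ring A] [Algebra k A] :
    Type (max v w) :=
  TrivSqZeroExt A (DualBimodule k A)

/-! ### Brauer graph algebras -/

/-- A Brauer graph with vertex set `V` and edge set `E` (loops and multiple edges are allowed).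
Every edge `e` has two ends, the *germs* `(e, false)` and `(e, true)`, and each germ is attached to
a vertex. The permutation `next` sends a germ to its direct successor in the cyclic ordering of the
germs around their common vertex. -/
structure BrauerGraph (V : Type v) (E : Type u) where
  /-- The vertex to which a germ is attached. -/
  endpoint : E × Bool → V
  /-- The direct successor in the cyclic ordering. -/
  next : Equiv.Perm (E × Bool)
  endpoint_next : ∀ h, endpoint (next h) = endpoint h
  /-- The germs around one vertex form a single cycle. -/
  sameCycle : ∀ h h', endpoint h = endpoint h' → next.SameCycle h h'
  /-- The multiplicity of a vertex. -/
  mult : V → ℕ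
  mult_pos : ∀ x, 0 < mult x
  /-- The graph is connected. -/
  connected : ∀ x y : V,
    Relation.EqvGen (fun x y => ∃ e, endpoint (e, false) = x ∧ endpoint (e, true) = y) x y

namespace BrauerGraph

variable {V : Type v} {E : Type u} (Γ : BrauerGraph V E)

/-- The valency of a vertex: the number of germs attached to it (so a loop counts twice). -/
noncomputable def valency (x : V) : ℕ := Nat.card {h : E × Bool // Γ.endpoint h = x}

/-- A germ is truncated if it is attached to a leaf vertex of multiplicity one. Truncated germs
give no arrow. -/
def Truncated (h : E × Bool) : Prop :=
  Γ.valency (Γ.endpoint h) = 1 ∧ Γ.mult (Γ.endpoint h) = 1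

theorem truncated_next (h : E × Bool) : Γ.Truncated (Γ.next h) ↔ Γ.Truncated h := by
  unfold Truncated
  rw [Γ.endpoint_next]

/-- The other germ of the same edge. -/
def otherGerm (h : E × Bool) : E × Bool := (h.1, !h.2)

/-- The vertex set of the quiver of a Brauer graph: the set of edges of the graph. -/
def QuiverVertex (_Γ : BrauerGraph V E) : Type u := E

instance [Fintype E] : Fintype Γ.QuiverVertex := inferInstanceAs (Fintype E)

/-- The quiver of a Brauer graph: every germ `h` that is not truncated gives one arrow, from the
edge of `h` to the edge of the direct successor of `h`. -/
instance : Quiver.{u} Γ.QuiverVertex where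
  Hom i j := {h : E × Bool // ¬ Γ.Truncated h ∧ h.1 = i ∧ (Γ.next h).1 = j}

/-- The set of all arrows of the quiver, indexed by the germs from which they start. -/
def Arrow : Type u := {h : E × Bool // ¬ Γ.Truncated h}

namespace Arrow

variable {Γ}

/-- The source `s(α)`. -/
def src (α : Γ.Arrow) : Γ.QuiverVertex := α.1.1

/-- The target `t(α)`. -/
def tgt (α : Γ.Arrow) : Γ.QuiverVertex := (Γ.next α.1).1

/-- The arrow as a morphism of the quiver. -/
def hom (α : Γ.Arrow) : α.src ⟶ α.tgt := ⟨α.1, α.2, rfl, rfl⟩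

/-- The vertex of the Brauer graph whose cycle contains the arrow. -/
def vertex (α : Γ.Arrow) : V := Γ.endpoint α.1

/-- The arrow that follows `α` in its cycle. -/
def succ (α : Γ.Arrow) : Γ.Arrow := ⟨Γ.next α.1, fun h => α.2 ((Γ.truncated_next _).1 h)⟩

/-- The path of length `n` that starts with `α` and follows the cycle of `α`. -/
def walk (α : Γ.Arrow) : (n : ℕ) → Quiver.Path α.src ((succ^[n] α).src)
  | 0 => Quiver.Path.nil
  | n + 1 => α.hom.toPath.comp (walk α.succ n)

end Arrow

section Algebra

variable (k : Type w) [Field k]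

/-- For an arrow `α` starting at `i` that belongs to the vertex `x` of the graph, the cycle
`C_{x,i}` that goes once around `x`, starting with `α`. -/
noncomputable def cycle (α : Γ.Arrow) : PathAlgebra k Γ.QuiverVertex :=
  PathAlgebra.ofPath k (α.walk (Γ.valency α.vertex))

variable [Fintype E]

/-- The relations of a Brauer graph algebra. -/
def relations : Set (PathAlgebra k Γ.QuiverVertex) :=
  {r | ∃ α β : Γ.Arrow, β.1 = otherGerm α.1 ∧
    r = Γ.cycle k α ^ Γ.mult α.vertex - Γ.cycle k β ^ Γ.mult β.vertex} ∪
  {r | ∃ α : Γ.Arrow, Γ.Truncated (otherGerm α.1) ∧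
    r = Γ.cycle k α ^ Γ.mult α.vertex * PathAlgebra.ofArrow k α.hom} ∪
  {r | ∃ α β : Γ.Arrow, α.tgt = β.src ∧ β ≠ α.succ ∧
    r = PathAlgebra.ofArrow k α.hom * PathAlgebra.ofArrow k β.hom}

/-- The ideal generated by the relations. -/
noncomputable def ideal : TwoSidedIdeal (PathAlgebra k Γ.QuiverVertex) :=
  TwoSidedIdeal.span (Γ.relations k)

/-- The Brauer graph algebra of a Brauer graph. -/
abbrev algebra : Type (max u w) := QuotientAlgebra (Γ.ideal k)

/-- A cutting set: it contains exactly one arrow of every vertex cycle. The vertex cycles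
correspond to the vertices of the graph that have an arrow. -/
def IsCuttingSet (D : Set Γ.Arrow) : Prop :=
  ∀ x : V, (∃ α : Γ.Arrow, α.vertex = x) → ∃! α : Γ.Arrow, α ∈ D ∧ α.vertex = x

/-- The ideal generated by the relations of the Brauer graph algebra and a set of arrows. -/
noncomputable def cutIdeal (D : Set Γ.Arrow) : TwoSidedIdeal (PathAlgebra k Γ.QuiverVertex) :=
  TwoSidedIdeal.span ((Γ.ideal k : Set (PathAlgebra k Γ.QuiverVertex)) ∪
    (fun α : Γ.Arrow => PathAlgebra.ofArrow k α.hom) '' D)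

/-- The admissible cut with respect to a cutting set `D`. -/
abbrev admissibleCut (D : Set Γ.Arrow) : Type (max u w) := QuotientAlgebra (Γ.cutIdeal k D)

end Algebra

end BrauerGraph

/-! Everything rests on one linear form on `kQ`: the `trace`, which is 1 on the paths that go
exactly once around a vertex of valency at least two (the full paths) and 0 on all other paths. A
rotation of a full path is full, so the trace is symmetric: `tr(xy) = tr(yx)`. The ideal of the
Brauer graph algebra is exactly the radical of the form `(x, y) ↦ tr(xy)`
(`trace_mul_eq_zero_of_mem_ideal`, `mem_ideal_of_trace_mul_eq_zero`). Indeed, modulo the relations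
every path is a proper part of a full path (extendable), or full, or zero; the coefficient of an
extendable path in `x` is `tr(qx)` for a complementary path `q`, and full paths with the same source
are identified.

Let `π` be the endomorphism of `kQ` that kills the arrows of `D` and fixes the others
(`cutFreePart`). A full path has exactly one arrow in `D`. "At least one" gives `tr ∘ π = 0`; "at
most one" gives `tr(xy) = 0` for `x`, `y` in the kernel of `π`. Moreover, the ideal `J` of the cut
is the preimage under `π` of the ideal `I` of the Brauer graph algebra (`mem_cutIdeal_iff`).

For (b), send `x` to its class in `A` together with the form `a ↦ tr(π(a)x)`. The two vanishing
statements make this multiplicative (`trace_cutFreePart_mul_mul`), the description of `I` as a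
radical gives the kernel `I`, and nondegeneracy with finite dimension gives surjectivity.

For (a), delete the arrows of `D` from the quiver. A path there is never full, so it is extendable
or contains a turn, that is, two consecutive arrows that do not follow a vertex cycle. Extendable
paths do not occur in any element of the remaining ideal, so the turns generate it. The gentle
conditions then express that an edge has only two germs: one continues an arrow along its cycle and
the other makes a turn. -/

/-! ### Paths as words in the labels of their arrows. -/

section Words

variable {Q : Type*} [Quiver Q] {L : Type*}

/-- The list of labels of the arrows of a path. -/
def Quiver.Path.labels (lab : ∀ {a b : Q}, (a ⟶ b) → L) {a : Q} :
    ∀ {b : Q}, Quiver.Path a b → List L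
  | _, .nil => []
  | _, .cons p f => p.labels lab ++ [lab f]

variable (lab : ∀ {a b : Q}, (a ⟶ b) → L)

theorem Quiver.Path.labels_comp {a b c : Q} (p : Quiver.Path a b) (q : Quiver.Path b c) :
    (p.comp q).labels lab = p.labels lab ++ q.labels lab := by
  induction q with
  | nil => simp [labels]
  | cons q f ih => simp [labels, ih]

theorem Quiver.Path.length_labels {a b : Q} (p : Quiver.Path a b) :
    (p.labels lab).length = p.length := by
  induction p with
  | nil => rfl
  | cons p f ih => simp [labels, ih]

/-- The common source is needed because all trivial paths have the empty word; the target is then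
determined, hence the equality in the sigma type. -/
theorem Quiver.Path.labels_injective
    (hlab : ∀ {a b c d : Q} (f : a ⟶ b) (g : c ⟶ d), lab f = lab g →
      (⟨a, b, f⟩ : Σ a b : Q, (a ⟶ b)) = ⟨c, d, g⟩)
    {a b b' : Q} (p : Quiver.Path a b) (p' : Quiver.Path a b')
    (h : p.labels lab = p'.labels lab) :
    (⟨a, b, p⟩ : QuiverPath Q) = ⟨a, b', p'⟩ := by
  induction p generalizing b' with
  | nil =>
    cases p' with
    | nil => rfl
    | cons p' f' => simp [labels] at h
  | cons p f ih =>
    cases p' with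
    | nil => simp [labels] at h
    | cons p' f' =>
      obtain ⟨h1, h2⟩ := List.append_inj' h rfl
      have h3 := ih p' h1
      have h4 := hlab f f' (by simpa using h2)
      cases h3
      cases h4
      rfl

end Words

/-! ### Germs around a vertex, full lists, and the germs of a path. -/

namespace BrauerGraph

variable {V : Type v} {E : Type u} (Γ : BrauerGraph V E)

/-- The germs around the vertex of `h` in their cyclic ordering, starting with `h`. -/
noncomputable def germCycle (h : E × Bool) : List (E × Bool) :=
  List.iterate Γ.next h (Γ.valency (Γ.endpoint h))

/-- A list of germs is full if it goes once around a vertex of valency at least two. -/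
def IsFull (l : List (E × Bool)) : Prop :=
  ∃ h, Γ.next h ≠ h ∧ l = Γ.germCycle h

variable {Γ}

theorem sameCycle_iff {h g : E × Bool} :
    Γ.next.SameCycle h g ↔ Γ.endpoint h = Γ.endpoint g := by
  refine ⟨?_, Γ.sameCycle h g⟩
  have key : ∀ (n : ℕ) (x : E × Bool), Γ.endpoint ((Γ.next ^ n) x) = Γ.endpoint x := by
    intro n
    induction n with
    | zero => simp
    | succ n ih => intro x; rw [pow_succ, Equiv.Perm.mul_apply, ih, Γ.endpoint_next]
  rintro ⟨n, rfl⟩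
  obtain ⟨m, rfl | rfl⟩ := n.eq_nat_or_neg
  · simp [key]
  · rw [← key m ((Γ.next ^ (-(m : ℤ))) h), ← Equiv.Perm.mul_apply, zpow_neg, zpow_natCast,
      mul_inv_cancel, Equiv.Perm.one_apply]

theorem valency_eq_one_iff (h : E × Bool) :
    Γ.valency (Γ.endpoint h) = 1 ↔ Γ.next h = h := by
  unfold valency
  rw [Nat.card_eq_one_iff_unique]
  constructor
  · rintro ⟨hs, -⟩
    exact congrArg Subtype.val (hs.elim
      (⟨Γ.next h, Γ.endpoint_next h⟩ : {g // Γ.endpoint g = Γ.endpoint h}) ⟨h, rfl⟩)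
  · intro hh
    refine ⟨⟨fun a b => Subtype.ext ?_⟩, ⟨⟨h, rfl⟩⟩⟩
    have key : ∀ g : {g // Γ.endpoint g = Γ.endpoint h}, g.1 = h := fun g =>
      ((sameCycle_iff.2 g.2).eq_of_right hh)
    rw [key a, key b]

theorem truncated_iff (hmult : ∀ x, Γ.mult x = 1) (h : E × Bool) :
    Γ.Truncated h ↔ Γ.next h = h := by
  rw [Truncated, valency_eq_one_iff]
  simp [hmult]

section Finite

/-- Gives access to the theory of cycles of permutations. The germ must be moved by `next`: for a
fixed germ `toList` is empty, while `germCycle` has one element. -/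
theorem germCycle_eq_toList [Fintype (E × Bool)] [DecidableEq (E × Bool)] {h : E × Bool}
    (hh : Γ.next h ≠ h) : Γ.germCycle h = Γ.next.toList h := by
  rw [germCycle, Equiv.Perm.toList]
  congr 1
  rw [valency, ← Nat.card_eq_finsetCard]
  refine Nat.card_congr (Equiv.subtypeEquivRight fun g => ?_)
  rw [Equiv.Perm.mem_support_cycleOf_iff' hh, sameCycle_iff, eq_comm]

variable [Finite E]

/-- A rotation of a full list is the same cycle read from another germ. This is the source of the
symmetry of the trace. -/
theorem IsFull.append_comm {l₁ l₂ : List (E × Bool)} (h : Γ.IsFull (l₁ ++ l₂)) :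
    Γ.IsFull (l₂ ++ l₁) := by
  classical
  have := Fintype.ofFinite (E × Bool)
  obtain ⟨g, hg, hl⟩ := h
  have hg' : Γ.next ((Γ.next ^ l₁.length) g) ≠ (Γ.next ^ l₁.length) g := by
    rw [← Equiv.Perm.mul_apply, ← pow_succ', pow_succ, Equiv.Perm.mul_apply]
    exact fun h => hg ((Γ.next ^ l₁.length).injective h)
  refine ⟨(Γ.next ^ l₁.length) g, hg', ?_⟩
  rw [germCycle_eq_toList hg', Equiv.Perm.toList_pow_apply_eq_rotate,
    ← germCycle_eq_toList hg, ← hl, List.rotate_append_length_eq]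

theorem two_le_valency {h : E × Bool} (hh : Γ.next h ≠ h) : 2 ≤ Γ.valency (Γ.endpoint h) := by
  have h1 : Γ.valency (Γ.endpoint h) ≠ 1 := fun h1 => hh ((valency_eq_one_iff h).1 h1)
  have h0 : Γ.valency (Γ.endpoint h) ≠ 0 := by
    have : Nonempty {g // Γ.endpoint g = Γ.endpoint h} := ⟨⟨h, rfl⟩⟩
    exact Nat.card_pos.ne'
  omega

theorem exists_germCycle_eq_cons {h : E × Bool} (hh : Γ.next h ≠ h) :
    ∃ l, Γ.germCycle h = h :: Γ.next h :: l := by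
  obtain ⟨n, hn⟩ := Nat.exists_eq_add_of_le (two_le_valency hh)
  exact ⟨List.iterate Γ.next (Γ.next (Γ.next h)) n, by rw [germCycle, hn, add_comm]; rfl⟩

theorem IsFull.exists_eq_cons {l : List (E × Bool)} (h : Γ.IsFull l) :
    ∃ g g' l', l = g :: g' :: l' := by
  obtain ⟨g, hg, rfl⟩ := h
  exact ⟨g, Γ.next g, exists_germCycle_eq_cons hg⟩

theorem IsFull.eq_germCycle {g : E × Bool} {l : List (E × Bool)} (h : Γ.IsFull (g :: l)) :
    Γ.next g ≠ g ∧ g :: l = Γ.germCycle g := by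
  obtain ⟨g', hg, hl⟩ := h
  obtain ⟨l', hl'⟩ := exists_germCycle_eq_cons hg
  have h2 : g = g' := (List.cons.inj (hl.trans hl')).1
  subst h2
  exact ⟨hg, hl⟩

theorem IsFull.eq_next {g g' : E × Bool} {l : List (E × Bool)} (h : Γ.IsFull (g :: g' :: l)) :
    g' = Γ.next g := by
  obtain ⟨hg, hl⟩ := h.eq_germCycle
  obtain ⟨l', hl'⟩ := exists_germCycle_eq_cons hg
  exact (List.cons.inj (List.cons.inj (hl.trans hl')).2).1

theorem IsFull.next_last {g g' : E × Bool} {l : List (E × Bool)}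
    (h : Γ.IsFull (g :: l ++ [g'])) : g = Γ.next g' :=
  IsFull.eq_next (l := l) h.append_comm

theorem IsFull.nodup {l : List (E × Bool)} (h : Γ.IsFull l) : l.Nodup := by
  classical
  have := Fintype.ofFinite (E × Bool)
  obtain ⟨g, hg, rfl⟩ := h
  rw [germCycle_eq_toList hg]
  exact Equiv.Perm.nodup_toList _ _

theorem IsFull.mem_iff {l : List (E × Bool)} (h : Γ.IsFull l) {g g' : E × Bool} (hg : g ∈ l) :
    g' ∈ l ↔ Γ.endpoint g = Γ.endpoint g' := by
  classical
  have := Fintype.ofFinite (E × Bool)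
  obtain ⟨g₀, h₀, rfl⟩ := h
  rw [germCycle_eq_toList h₀, Equiv.Perm.mem_toList_iff, sameCycle_iff, Equiv.Perm.mem_support]
    at hg ⊢
  simp [h₀, hg.1]

/-- The first germ determines a full list, so a nonempty beginning has only one completion. -/
theorem IsFull.append_left_cancel {q l l' : List (E × Bool)} (hq : q ≠ [])
    (h : Γ.IsFull (q ++ l)) (h' : Γ.IsFull (q ++ l')) : l = l' := by
  obtain ⟨g, q, rfl⟩ := List.exists_cons_of_ne_nil hq
  exact List.append_cancel_left (as := g :: q)
    ((IsFull.eq_germCycle h).2.trans (IsFull.eq_germCycle h').2.symm)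

/-- The part `l` already contains every germ around its vertex, and a full list has no repetitions.
-/
theorem IsFull.eq_nil_of_append {q l : List (E × Bool)} (h : Γ.IsFull (q ++ l))
    (hl : Γ.IsFull l) : q = [] := by
  obtain ⟨g, g', l, rfl⟩ := hl.exists_eq_cons
  refine List.eq_nil_iff_forall_not_mem.2 fun x hx => ?_
  refine (List.nodup_append.1 h.nodup).2.2 x hx x ?_ rfl
  rw [hl.mem_iff List.mem_cons_self, ← h.mem_iff (by simp)]
  exact List.mem_append_left _ hx

end Finite

/-- The germ of an arrow of the quiver. -/
def homGerm {i j : Γ.QuiverVertex} (f : i ⟶ j) : E × Bool := Subtype.val f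

/-- The germs of the arrows of a path. -/
def germs {i j : Γ.QuiverVertex} (p : Quiver.Path i j) : List (E × Bool) :=
  p.labels (fun {_ _} f => homGerm f)

theorem homGerm_fst {i j : Γ.QuiverVertex} (f : i ⟶ j) : (homGerm f).1 = i :=
  (Subtype.property f).2.1

theorem next_homGerm_fst {i j : Γ.QuiverVertex} (f : i ⟶ j) : (Γ.next (homGerm f)).1 = j :=
  (Subtype.property f).2.2

theorem not_truncated_homGerm {i j : Γ.QuiverVertex} (f : i ⟶ j) : ¬ Γ.Truncated (homGerm f) :=
  (Subtype.property f).1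

@[simp] theorem homGerm_hom (α : Γ.Arrow) : homGerm α.hom = α.1 := rfl

@[simp] theorem germs_nil (i : Γ.QuiverVertex) : germs (Quiver.Path.nil : Quiver.Path i i) = [] :=
  rfl

@[simp] theorem germs_cons {i j l : Γ.QuiverVertex} (p : Quiver.Path i j) (f : j ⟶ l) :
    germs (p.cons f) = germs p ++ [homGerm f] :=
  rfl

@[simp] theorem germs_toPath {i j : Γ.QuiverVertex} (f : i ⟶ j) :
    germs f.toPath = [homGerm f] :=
  rfl

@[simp] theorem germs_comp {i j l : Γ.QuiverVertex} (p : Quiver.Path i j) (q : Quiver.Path j l) :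
    germs (p.comp q) = germs p ++ germs q :=
  Quiver.Path.labels_comp _ p q

theorem length_germs {i j : Γ.QuiverVertex} (p : Quiver.Path i j) :
    (germs p).length = p.length :=
  Quiver.Path.length_labels _ p

theorem germs_injective {i j j' : Γ.QuiverVertex} (p : Quiver.Path i j) (p' : Quiver.Path i j')
    (h : germs p = germs p') : (⟨i, j, p⟩ : QuiverPath Γ.QuiverVertex) = ⟨i, j', p'⟩ := by
  refine Quiver.Path.labels_injective _ ?_ p p' h
  rintro _ _ _ _ ⟨f, h1, rfl, rfl⟩ ⟨g, h2, rfl, rfl⟩ (rfl : f = g)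
  rfl

theorem germs_walk (n : ℕ) (α : Γ.Arrow) : germs (α.walk n) = List.iterate Γ.next α.1 n := by
  induction n generalizing α with
  | zero => rfl
  | succ n ih =>
    exact (germs_comp α.hom.toPath (α.succ.walk n)).trans (congrArg (α.1 :: ·) (ih α.succ))

theorem fst_eq_of_germs_eq_cons {i j : Γ.QuiverVertex} (p : Quiver.Path i j) {g : E × Bool}
    {l : List (E × Bool)} (h : germs p = g :: l) : g.1 = i := by
  induction p generalizing l with
  | nil => simp at h
  | cons p f ih =>
    cases p with
    | nil =>
      simp only [germs_cons, germs_nil, List.nil_append, List.cons.injEq] at h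
      rw [← h.1, homGerm_fst]
    | cons p' f' =>
      cases hl : germs (p'.cons f') with
      | nil => simp at hl
      | cons x xs =>
        rw [germs_cons, hl, List.cons_append, List.cons.injEq] at h
        exact ih (h.1 ▸ hl)

theorem next_fst_eq_of_germs_eq_append {i j : Γ.QuiverVertex} (p : Quiver.Path i j) {g : E × Bool}
    {l : List (E × Bool)} (h : germs p = l ++ [g]) : (Γ.next g).1 = j := by
  cases p with
  | nil => simp at h
  | cons p f =>
    have := (List.append_inj' h rfl).2
    simp only [List.cons.injEq, and_true] at this
    rw [← this, next_homGerm_fst]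

variable [Finite E]

/-- The successor of the last germ is the first germ, so the path closes up. -/
theorem eq_of_isFull {i j : Γ.QuiverVertex} (p : Quiver.Path i j) (h : Γ.IsFull (germs p)) :
    i = j := by
  obtain ⟨g, g', l, hl⟩ := h.exists_eq_cons
  obtain ⟨m, x, hm⟩ := List.eq_nil_or_concat' (g' :: l) |>.resolve_left (by simp)
  rw [hm] at hl
  rw [hl] at h
  have h1 := IsFull.next_last (l := m) h
  rw [← fst_eq_of_germs_eq_cons p hl, ← next_fst_eq_of_germs_eq_append p (l := g :: m) hl, h1]

end BrauerGraph

/-! ### Coefficients, and arguments path by path. -/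

namespace PathAlgebra

variable {k : Type w} [Field k] {Q : Type u} [Quiver.{v} Q]

/-- The coefficient of a path in an element of the path algebra. -/
noncomputable def coeff (p : QuiverPath Q) : PathAlgebra k Q →ₗ[k] k :=
  (Finsupp.lapply p : (QuiverPath Q →₀ k) →ₗ[k] k)

theorem coeff_ofPath_self {a b : Q} (p : Quiver.Path a b) :
    coeff ⟨a, b, p⟩ (ofPath k p) = 1 :=
  Finsupp.single_eq_same

theorem coeff_ofPath_of_ne {a b : Q} (p : Quiver.Path a b) {q : QuiverPath Q}
    (h : (⟨a, b, p⟩ : QuiverPath Q) ≠ q) : coeff q (ofPath k p) = 0 :=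
  Finsupp.single_eq_of_ne h.symm

/-- Only the paths that occur in `x` have to be treated. Later, nonzero coefficients are what rules
out extendable paths. -/
theorem mem_of_forall_coeff {K : Submodule k (PathAlgebra k Q)} {x : PathAlgebra k Q}
    (h : ∀ {a b : Q} (p : Quiver.Path a b), coeff ⟨a, b, p⟩ x ≠ 0 → ofPath k p ∈ K) : x ∈ K := by
  have hx : x = Finsupp.sum (x : QuiverPath Q →₀ k)
      (fun p c => (c • ofPath k p.2.2 : PathAlgebra k Q)) := by
    refine (Finsupp.sum_single (x : QuiverPath Q →₀ k)).symm.trans ?_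
    refine Finsupp.sum_congr fun p _ => ?_
    exact (Finsupp.smul_single_one p _).symm
  rw [hx]
  refine Submodule.sum_mem _ fun p hp => K.smul_mem _ (h p.2.2 ?_)
  exact Finsupp.mem_support_iff.1 hp

theorem induction_on {P : PathAlgebra k Q → Prop} (x : PathAlgebra k Q) (zero : P 0)
    (add : ∀ x y, P x → P y → P (x + y)) (smul : ∀ (c : k) x, P x → P (c • x))
    (path : ∀ {a b : Q} (p : Quiver.Path a b), P (ofPath k p)) : P x :=
  mem_of_forall_coeff (x := x)
    (K := { carrier := {x | P x}
            zero_mem' := zero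
            add_mem' := fun {x y} hx hy => add x y hx hy
            smul_mem' := smul }) fun p _ => path p

theorem ofPath_cons {a b c : Q} (p : Quiver.Path a b) (f : b ⟶ c) :
    ofPath k (p.cons f) = ofPath k p * ofArrow k f :=
  (ofPath_mul_ofPath k p f.toPath).symm

variable [Fintype Q]

/-- A two-sided ideal of the path algebra as a subspace. -/
noncomputable def idealSubmodule (I : TwoSidedIdeal (PathAlgebra k Q)) : Submodule k (PathAlgebra k Q) :=
  I.asIdeal.restrictScalars k

theorem mem_idealSubmodule {I : TwoSidedIdeal (PathAlgebra k Q)} {x : PathAlgebra k Q} :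
    x ∈ idealSubmodule I ↔ x ∈ I :=
  Iff.rfl

end PathAlgebra

/-! ### The trace form and extendable paths. -/

namespace BrauerGraph

open PathAlgebra

variable {V : Type v} {E : Type u} {Γ : BrauerGraph V E}

/-- The arrow of a Brauer graph given by a morphism of its quiver. -/
def toArrow {i j : Γ.QuiverVertex} (f : i ⟶ j) : Γ.Arrow :=
  ⟨homGerm f, not_truncated_homGerm f⟩

theorem eq_of_homGerm_eq {i j j' : Γ.QuiverVertex} (f : i ⟶ j) (g : i ⟶ j')
    (h : homGerm f = homGerm g) :
    (⟨j, f⟩ : Σ j : Γ.QuiverVertex, (i ⟶ j)) = ⟨j', g⟩ := by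
  obtain ⟨f, h1, rfl, rfl⟩ := f
  obtain ⟨g, h2, h3, rfl⟩ := g
  obtain rfl : f = g := h
  rfl

theorem ofArrow_eq (k : Type w) [Field k] {i j : Γ.QuiverVertex} (f : i ⟶ j) :
    ofArrow k f = ofArrow k (toArrow f).hom := by
  obtain ⟨f, h1, rfl, rfl⟩ := f
  rfl

theorem ofPath_eq_of_germs_eq (k : Type w) [Field k] {i j i' j' : Γ.QuiverVertex}
    (p : Quiver.Path i j) (p' : Quiver.Path i' j') (hi : i = i') (h : germs p = germs p') :
    ofPath k p = ofPath k p' := by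
  subst hi
  have := germs_injective p p' h
  cases this
  rfl

theorem germs_walk_valency (α : Γ.Arrow) :
    germs (α.walk (Γ.valency α.vertex)) = Γ.germCycle α.1 :=
  germs_walk _ _

theorem isFull_germCycle (hmult : ∀ x, Γ.mult x = 1) (α : Γ.Arrow) :
    Γ.IsFull (Γ.germCycle α.1) :=
  ⟨α.1, fun h => α.2 ((truncated_iff hmult _).2 h), rfl⟩

/-- A path is extendable if it is a proper part of a closed path that goes once around a vertex of
the Brauer graph. -/
def Extendable {i j : Γ.QuiverVertex} (p : Quiver.Path i j) : Prop :=
  ∃ q : Quiver.Path j i, q.length ≠ 0 ∧ Γ.IsFull (germs q ++ germs p)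

open Classical in
/-- The linear form on the path algebra that sends a path to one if it goes once around a vertex
of the Brauer graph, and to zero otherwise. -/
noncomputable def trace (k : Type w) [Field k] (Γ : BrauerGraph V E) :
    PathAlgebra k Γ.QuiverVertex →ₗ[k] k :=
  (Finsupp.linearCombination k
    (fun p : QuiverPath Γ.QuiverVertex => if Γ.IsFull (germs p.2.2) then (1 : k) else 0))

section Trace

variable {k : Type w} [Field k]

theorem trace_ofPath_of_isFull {i j : Γ.QuiverVertex} {p : Quiver.Path i j}
    (h : Γ.IsFull (germs p)) : Γ.trace k (ofPath k p) = 1 := by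
  refine (Finsupp.linearCombination_single k 1 _).trans ?_
  rw [one_smul, if_pos h]

theorem trace_ofPath_of_not_isFull {i j : Γ.QuiverVertex} {p : Quiver.Path i j}
    (h : ¬ Γ.IsFull (germs p)) : Γ.trace k (ofPath k p) = 0 := by
  refine (Finsupp.linearCombination_single k 1 _).trans ?_
  rw [one_smul, if_neg h]

variable [Fintype E]

theorem not_isFull_nil : ¬ Γ.IsFull [] := fun h => by
  obtain ⟨_, _, _, h⟩ := h.exists_eq_cons
  cases h

theorem exists_closed_path (hmult : ∀ x, Γ.mult x = 1) (α : Γ.Arrow) {i : Γ.QuiverVertex}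
    (hi : α.src = i) : ∃ w : Quiver.Path i i, germs w = Γ.germCycle α.1 := by
  subst hi
  have h2 := germs_walk_valency α
  have h3 := eq_of_isFull (α.walk (Γ.valency α.vertex)) (h2 ▸ isFull_germCycle hmult α)
  -- The walk ends at the source of an iterate of `α`; once it is generalized, the proved equality
  -- of its ends can be rewritten in its type.
  generalize α.walk (Γ.valency α.vertex) = w at h2
  revert w
  rw [← h3]
  exact fun w hw => ⟨w, hw⟩

theorem trace_mul_comm (x y : PathAlgebra k Γ.QuiverVertex) :
    Γ.trace k (x * y) = Γ.trace k (y * x) := by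
  induction x using PathAlgebra.induction_on with
  | zero => simp
  | add x x' h h' => rw [add_mul, mul_add, map_add, map_add, h, h']
  | smul c x h => rw [smul_mul_assoc, mul_smul_comm, map_smul, map_smul, h]
  | @path a b p =>
  induction y using PathAlgebra.induction_on with
  | zero => simp
  | add x x' h h' => rw [add_mul, mul_add, map_add, map_add, h, h']
  | smul c x h => rw [smul_mul_assoc, mul_smul_comm, map_smul, map_smul, h]
  | @path c d q =>
  have key : ∀ {a b c d : Γ.QuiverVertex} (p : Quiver.Path a b) (q : Quiver.Path c d),
      a ≠ d → Γ.trace k (ofPath k p * ofPath k q) = 0 := by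
    intro a b c d p q hne
    by_cases hbc : b = c
    · subst hbc
      rw [ofPath_mul_ofPath]
      exact trace_ofPath_of_not_isFull fun h => hne (eq_of_isFull _ h)
    · rw [ofPath_mul_ofPath_of_ne k _ _ hbc, map_zero]
  by_cases had : a = d
  · by_cases hbc : b = c
    · subst had hbc
      rw [ofPath_mul_ofPath, ofPath_mul_ofPath]
      by_cases h : Γ.IsFull (germs (p.comp q))
      · rw [trace_ofPath_of_isFull h, trace_ofPath_of_isFull]
        rw [germs_comp] at h ⊢
        exact h.append_comm
      · rw [trace_ofPath_of_not_isFull h, trace_ofPath_of_not_isFull]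
        rw [germs_comp] at h ⊢
        exact fun h' => h h'.append_comm
    · rw [key q p (Ne.symm hbc), ofPath_mul_ofPath_of_ne k _ _ hbc, map_zero]
  · rw [key p q had, ofPath_mul_ofPath_of_ne k _ _ (Ne.symm had), map_zero]

/-- Take for `y` a nontrivial path `q` that completes `p` to a full path. The completion of `q` is
unique, so `q` followed by another path is never full. -/
theorem Extendable.exists_trace_mul_eq_coeff {i j : Γ.QuiverVertex} {p : Quiver.Path i j}
    (hp : Extendable p) : ∃ y : PathAlgebra k Γ.QuiverVertex,
      ∀ x, Γ.trace k (y * x) = coeff ⟨i, j, p⟩ x := by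
  obtain ⟨q, hq, h⟩ := hp
  refine ⟨ofPath k q, fun x => ?_⟩
  induction x using PathAlgebra.induction_on with
  | zero => simp
  | add x x' h h' => rw [mul_add, map_add, map_add, h, h']
  | smul c x h => rw [mul_smul_comm, map_smul, map_smul, h]
  | @path i' j' p' =>
  by_cases hpp : (⟨i', j', p'⟩ : QuiverPath Γ.QuiverVertex) = ⟨i, j, p⟩
  · cases hpp
    rw [coeff_ofPath_self, ofPath_mul_ofPath, trace_ofPath_of_isFull]
    rwa [germs_comp]
  · rw [coeff_ofPath_of_ne _ hpp]
    by_cases hi : i = i'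
    · subst hi
      rw [ofPath_mul_ofPath, trace_ofPath_of_not_isFull]
      rw [germs_comp]
      intro h'
      refine hpp (germs_injective _ _ (IsFull.append_left_cancel ?_ h' h))
      intro h0
      rw [← length_germs, h0] at hq
      exact hq rfl
    · rw [ofPath_mul_ofPath_of_ne k _ _ hi, map_zero]

end Trace

section Extendable

theorem germs_ne_nil {i j : Γ.QuiverVertex} {p : Quiver.Path i j} :
    germs p ≠ [] ↔ p.length ≠ 0 := by
  rw [← length_germs, Ne, Ne, List.length_eq_zero_iff]

variable [Fintype E]

theorem extendable_nil (hmult : ∀ x, Γ.mult x = 1) (α : Γ.Arrow) {i : Γ.QuiverVertex}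
    (hi : α.src = i) : Extendable (Quiver.Path.nil : Quiver.Path i i) := by
  obtain ⟨w, hw⟩ := exists_closed_path hmult α hi
  have h := isFull_germCycle hmult α
  refine ⟨w, germs_ne_nil.1 ?_, ?_⟩
  · rw [hw]
    exact fun h0 => not_isFull_nil (h0 ▸ h)
  · rw [hw, germs_nil, List.append_nil]
    exact h

theorem extendable_toPath (hmult : ∀ x, Γ.mult x = 1) {i j : Γ.QuiverVertex} (f : i ⟶ j) :
    Extendable f.toPath := by
  obtain ⟨w, hw⟩ := exists_closed_path hmult (toArrow f) (homGerm_fst f)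
  have h := isFull_germCycle hmult (toArrow f)
  obtain ⟨l, hl⟩ := exists_germCycle_eq_cons
    (fun h => (toArrow f).2 ((truncated_iff hmult _).2 h))
  rw [hl] at hw
  obtain ⟨j', g, q, rfl, -⟩ := w.length_ne_zero_iff_eq_comp.1
    (germs_ne_nil.1 (by rw [hw]; exact List.cons_ne_nil _ _))
  rw [germs_comp, germs_toPath] at hw
  cases eq_of_homGerm_eq f g (List.cons.inj hw).1.symm
  rw [hl, ← hw] at h
  refine ⟨q, germs_ne_nil.1 fun h0 => ?_, ?_⟩
  · rw [h0] at hw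
    simpa using congrArg List.length hw
  · rw [germs_toPath]
    exact h.append_comm

/-- If `f` follows the last arrow of `p` in its cycle, then `f` is the first arrow of the complement
`q`. Moving it from `q` to `p` leaves a shorter complement, and when nothing is left the new path is
full. Otherwise the last arrow of `p` and `f` form a turn. -/
theorem Extendable.cons (hmult : ∀ x, Γ.mult x = 1) {i j l : Γ.QuiverVertex}
    {p : Quiver.Path i j} (hp : Extendable p) (f : j ⟶ l) :
    Extendable (p.cons f) ∨ Γ.IsFull (germs (p.cons f)) ∨
      ∃ (j' : Γ.QuiverVertex) (p' : Quiver.Path i j') (g : j' ⟶ j),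
        p = p'.cons g ∧ Γ.next (homGerm g) ≠ homGerm f := by
  cases p with
  | nil => exact Or.inl (extendable_toPath hmult f)
  | @cons j' _ p' g =>
    by_cases hgf : Γ.next (homGerm g) = homGerm f
    · obtain ⟨q, hq, h⟩ := hp
      obtain ⟨l', f', q', rfl, -⟩ := q.length_ne_zero_iff_eq_comp.1 hq
      have h1 : homGerm f' = Γ.next (homGerm g) :=
        IsFull.next_last (l := germs q' ++ germs p') (by simpa using h)
      cases eq_of_homGerm_eq f f' (hgf.symm.trans h1.symm)
      have h2 : Γ.IsFull (germs q' ++ germs ((p'.cons g).cons f)) := by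
        rw [germs_comp, germs_toPath, List.append_assoc] at h
        have := h.append_comm
        rwa [List.append_assoc] at this
      by_cases h0 : q'.length = 0
      · right; left
        have : germs q' = [] := by
          by_contra hne
          exact germs_ne_nil.1 hne h0
        rwa [this, List.nil_append] at h2
      · exact Or.inl ⟨q', h0, h2⟩
    · exact Or.inr (Or.inr ⟨j', p', g, rfl, hgf⟩)

end Extendable

end BrauerGraph

/-! ### The ideal of the Brauer graph algebra is the radical of the trace form. -/

namespace BrauerGraph

open PathAlgebra

variable {V : Type v} {E : Type u} {Γ : BrauerGraph V E} {k : Type w} [Field k]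

theorem cycle_eq_ofPath (α : Γ.Arrow) {i : Γ.QuiverVertex} (hi : i = α.src)
    {w : Quiver.Path i i} (hw : germs w = Γ.germCycle α.1) : Γ.cycle k α = ofPath k w :=
  ofPath_eq_of_germs_eq k _ w hi.symm (by rw [germs_walk_valency, hw])

theorem isFull_walk (hmult : ∀ x, Γ.mult x = 1) (α : Γ.Arrow) :
    Γ.IsFull (germs (α.walk (Γ.valency α.vertex))) := by
  rw [germs_walk_valency]
  exact isFull_germCycle hmult α

theorem eq_otherGerm {g h : E × Bool} (h1 : g.1 = h.1) (hne : g ≠ h) : g = otherGerm h := by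
  obtain ⟨e, b⟩ := h
  obtain ⟨e', b'⟩ := g
  obtain rfl : e' = e := h1
  have hb : b' ≠ b := fun hb => hne (by rw [hb])
  cases b <;> cases b' <;> simp_all [otherGerm]

variable [Fintype E]

theorem ofArrow_mul_ofArrow_mem_ideal {i j l : Γ.QuiverVertex} (f : i ⟶ j) (g : j ⟶ l)
    (h : Γ.next (homGerm f) ≠ homGerm g) : ofArrow k f * ofArrow k g ∈ Γ.ideal k := by
  refine TwoSidedIdeal.subset_span (Or.inr ⟨toArrow f, toArrow g, ?_, ?_, ?_⟩)
  · exact (next_homGerm_fst f).trans (homGerm_fst g).symm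
  · exact fun h' => h (congrArg Subtype.val h').symm
  · rw [← ofArrow_eq, ← ofArrow_eq]

theorem cycle_sub_cycle_mem_ideal (hmult : ∀ x, Γ.mult x = 1) {α β : Γ.Arrow}
    (h : α.src = β.src) : Γ.cycle k α - Γ.cycle k β ∈ Γ.ideal k := by
  by_cases hαβ : β.1 = α.1
  · obtain rfl : β = α := Subtype.ext hαβ
    rw [sub_self]
    exact TwoSidedIdeal.zero_mem _
  · refine TwoSidedIdeal.subset_span (Or.inl (Or.inl ⟨α, β, eq_otherGerm h.symm hαβ, ?_⟩))
    rw [hmult, hmult, pow_one, pow_one]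

theorem exists_ofPath_eq_cycle (hmult : ∀ x, Γ.mult x = 1) {i j : Γ.QuiverVertex}
    {p : Quiver.Path i j} (hp : Γ.IsFull (germs p)) :
    ∃ α : Γ.Arrow, α.src = i ∧ germs p = Γ.germCycle α.1 ∧ Γ.cycle k α = ofPath k p := by
  obtain rfl := eq_of_isFull p hp
  obtain ⟨h, hh, hl⟩ := id hp
  have hα : ¬ Γ.Truncated h := fun h' => hh ((truncated_iff hmult h).1 h')
  obtain ⟨l, hl'⟩ := exists_germCycle_eq_cons hh
  have h1 : h.1 = i := fst_eq_of_germs_eq_cons p (hl.trans hl')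
  exact ⟨⟨h, hα⟩, h1, hl, cycle_eq_ofPath _ h1.symm hl⟩

/-- If `f` does not restart the cycle of `p`, the last two arrows form a turn. If it does, either
the relation for a truncated other germ applies, or the cycle can be exchanged for the one of the
other germ, after which `f` makes a turn. -/
theorem ofPath_cons_mem_ideal_of_isFull (hmult : ∀ x, Γ.mult x = 1) {i j l : Γ.QuiverVertex}
    {p : Quiver.Path i j} (hp : Γ.IsFull (germs p)) (f : j ⟶ l) :
    ofPath k (p.cons f) ∈ Γ.ideal k := by
  obtain rfl := eq_of_isFull p hp
  have key : ∀ (β : Γ.Arrow) {w : Quiver.Path i i}, germs w = Γ.germCycle β.1 →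
      β.1 ≠ homGerm f → ofPath k (w.cons f) ∈ Γ.ideal k := by
    intro β w hw hne
    have hfull := isFull_germCycle hmult β
    obtain ⟨m, hm⟩ := exists_germCycle_eq_cons (fun h => β.2 ((truncated_iff hmult _).2 h))
    cases w with
    | nil =>
      rw [hm] at hw
      cases hw
    | cons w g =>
      rw [ofPath_cons, ofPath_cons, mul_assoc]
      refine TwoSidedIdeal.mul_mem_left _ _ _ (ofArrow_mul_ofArrow_mem_ideal g f fun h => ?_)
      refine hne (Eq.trans ?_ h)
      rw [← hw, germs_cons] at hfull
      rw [hm, germs_cons] at hw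
      cases hw' : germs w with
      | nil =>
        rw [hw'] at hw
        simpa using congrArg List.length hw
      | cons x xs =>
        rw [hw'] at hw hfull
        rw [← (List.cons.inj hw).1]
        exact IsFull.next_last hfull
  obtain ⟨α, hα, hpα, hc⟩ := exists_ofPath_eq_cycle (k := k) hmult hp
  by_cases hαf : α.1 = homGerm f
  · by_cases ht : Γ.Truncated (otherGerm α.1)
    · refine TwoSidedIdeal.subset_span (Or.inl (Or.inr ⟨α, ht, ?_⟩))
      obtain rfl : α = toArrow f := Subtype.ext hαf
      rw [hmult, pow_one, hc, ofPath_cons, ofArrow_eq]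
    · let β : Γ.Arrow := ⟨otherGerm α.1, ht⟩
      obtain ⟨w, hw⟩ := exists_closed_path hmult β (i := i) hα
      have h1 := key β hw fun h => by
        have h2 := congrArg Prod.snd (h.trans hαf.symm)
        simp [β, otherGerm] at h2
      have h3 : ofPath k (p.cons f) =
          (Γ.cycle k α - Γ.cycle k β) * ofArrow k f + ofPath k (w.cons f) := by
        rw [hc, cycle_eq_ofPath β hα.symm hw, ofPath_cons, ofPath_cons, sub_mul, sub_add_cancel]
      rw [h3]
      exact TwoSidedIdeal.add_mem _ (TwoSidedIdeal.mul_mem_right _ _ _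
        (cycle_sub_cycle_mem_ideal hmult rfl)) h1
  · exact key α hpα hαf

theorem extendable_or_isFull_or_mem_ideal (hmult : ∀ x, Γ.mult x = 1) (σ : Γ.QuiverVertex → Γ.Arrow)
    (hσ : ∀ i, (σ i).src = i) {i j : Γ.QuiverVertex} (p : Quiver.Path i j) :
    Extendable p ∨ Γ.IsFull (germs p) ∨ ofPath k p ∈ Γ.ideal k := by
  induction p with
  | nil => exact Or.inl (extendable_nil hmult (σ i) (hσ i))
  | cons p f ih =>
    obtain h | h | h := ih
    · obtain h | h | ⟨j', p', g, rfl, hg⟩ := h.cons hmult f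
      · exact Or.inl h
      · exact Or.inr (Or.inl h)
      · refine Or.inr (Or.inr ?_)
        rw [ofPath_cons, ofPath_cons, mul_assoc]
        exact TwoSidedIdeal.mul_mem_left _ _ _ (ofArrow_mul_ofArrow_mem_ideal g f hg)
    · exact Or.inr (Or.inr (ofPath_cons_mem_ideal_of_isFull hmult h f))
    · refine Or.inr (Or.inr ?_)
      rw [ofPath_cons]
      exact TwoSidedIdeal.mul_mem_right _ _ _ h

theorem trace_ofPath_mul_ofPath_of_isFull {i j i' : Γ.QuiverVertex} (q : Quiver.Path i j)
    {w : Quiver.Path i' i'} (hw : Γ.IsFull (germs w)) [Decidable (j = i' ∧ germs q = [])] :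
    Γ.trace k (ofPath k q * ofPath k w) = if j = i' ∧ germs q = [] then 1 else 0 := by
  by_cases hj : j = i'
  · subst hj
    rw [ofPath_mul_ofPath]
    by_cases hq : germs q = []
    · rw [trace_ofPath_of_isFull, if_pos ⟨rfl, hq⟩]
      rwa [germs_comp, hq, List.nil_append]
    · rw [trace_ofPath_of_not_isFull, if_neg (fun h => hq h.2)]
      rw [germs_comp]
      exact fun h => hq (h.eq_nil_of_append hw)
  · rw [ofPath_mul_ofPath_of_ne k _ _ hj, map_zero, if_neg (fun h => hj h.1)]

theorem trace_ofArrow_mul_mul_ofArrow {i j i' j' a b : Γ.QuiverVertex} (g : i ⟶ j)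
    (q : Quiver.Path a b) (f : i' ⟶ j') (h : homGerm g ≠ Γ.next (homGerm f)) :
    Γ.trace k (ofArrow k g * ofPath k q * ofArrow k f) = 0 := by
  rw [ofArrow, ofArrow]
  by_cases hj : j = a
  · subst hj
    rw [ofPath_mul_ofPath]
    by_cases hi : b = i'
    · subst hi
      rw [ofPath_mul_ofPath, trace_ofPath_of_not_isFull]
      rw [germs_comp, germs_comp, germs_toPath, germs_toPath]
      exact fun h' => h h'.next_last
    · rw [ofPath_mul_ofPath_of_ne k _ _ hi, map_zero]
  · rw [ofPath_mul_ofPath_of_ne k _ _ hj, zero_mul, map_zero]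

theorem trace_mul_eq_zero_of_mem_ideal (hmult : ∀ x, Γ.mult x = 1)
    {x : PathAlgebra k Γ.QuiverVertex} (hx : x ∈ Γ.ideal k) (y : PathAlgebra k Γ.QuiverVertex) :
    Γ.trace k (y * x) = 0 := by
  classical
  -- The radical of the trace form; the symmetry of the trace makes it two-sided, so only the
  -- generating relations have to be tested.
  let K : TwoSidedIdeal (PathAlgebra k Γ.QuiverVertex) :=
    TwoSidedIdeal.mk' {x | ∀ y, Γ.trace k (y * x) = 0} (fun y => by simp)
      (fun {a b} ha hb y => by rw [mul_add, map_add, ha, hb, add_zero])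
      (fun {a} ha y => by rw [mul_neg, map_neg, ha, neg_zero])
      (fun {a b} hb y => by rw [← mul_assoc, hb])
      (fun {a b} ha y => by rw [← mul_assoc, trace_mul_comm, ← mul_assoc, ha])
  suffices h : Γ.ideal k ≤ K by
    have := h hx
    rw [TwoSidedIdeal.mem_mk'] at this
    exact this y
  refine TwoSidedIdeal.span_le.2 fun r hr => ?_
  rw [SetLike.mem_coe, TwoSidedIdeal.mem_mk']
  intro y
  induction y using PathAlgebra.induction_on with
  | zero => simp
  | add x x' h h' => rw [add_mul, map_add, h, h', add_zero]
  | smul c x h => rw [smul_mul_assoc, map_smul, h, smul_zero]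
  | @path a b q =>
  have hcyc : ∀ {a b : Γ.QuiverVertex} (q : Quiver.Path a b) (α : Γ.Arrow),
      Γ.trace k (ofPath k q * Γ.cycle k α) = if b = α.src ∧ germs q = [] then 1 else 0 := by
    intro a b q α
    obtain ⟨w, hw⟩ := exists_closed_path hmult α rfl
    rw [cycle_eq_ofPath α rfl hw]
    exact trace_ofPath_mul_ofPath_of_isFull q (hw ▸ isFull_germCycle hmult α)
  obtain (⟨α, β, hαβ, rfl⟩ | ⟨α, -, rfl⟩) | ⟨α, β, hαβ, hne, rfl⟩ := hr
  · rw [hmult, hmult, pow_one, pow_one, mul_sub, map_sub, hcyc, hcyc]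
    have : β.src = α.src := by
      change β.1.1 = α.1.1
      rw [hαβ]
      rfl
    rw [this, sub_self]
  · rw [hmult, pow_one, ← mul_assoc, trace_mul_comm, ← mul_assoc, ofArrow]
    by_cases h : α.tgt = a
    · subst h
      rw [ofPath_mul_ofPath, hcyc, if_neg]
      rintro ⟨-, h⟩
      simp at h
    · rw [ofPath_mul_ofPath_of_ne k _ _ h, zero_mul, map_zero]
  · rw [← mul_assoc, trace_mul_comm, ← mul_assoc]
    exact trace_ofArrow_mul_mul_ofArrow β.hom q α.hom fun h => hne (Subtype.ext h)

/-- No extendable path occurs in `x`, so modulo the ideal `x` is a combination of one chosen cycle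
at each edge. The coefficients of these cycles are the traces `tr(e_i x)`, which vanish. -/
theorem mem_ideal_of_trace_mul_eq_zero (hmult : ∀ x, Γ.mult x = 1) (σ : Γ.QuiverVertex → Γ.Arrow)
    (hσ : ∀ i, (σ i).src = i) {x : PathAlgebra k Γ.QuiverVertex}
    (hx : ∀ y, Γ.trace k (y * x) = 0) : x ∈ Γ.ideal k := by
  classical
  -- The normal form `z ↦ Σ tr(e_i z) C_{σ i}`. On each path that occurs in `x` it agrees with the
  -- identity modulo the ideal, and it sends `x` itself to zero.
  let N : PathAlgebra k Γ.QuiverVertex →ₗ[k] PathAlgebra k Γ.QuiverVertex :=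
    ∑ i : Γ.QuiverVertex, LinearMap.smulRight
      (Γ.trace k ∘ₗ LinearMap.mulLeft k (ofPath k (Quiver.Path.nil : Quiver.Path i i)))
      (Γ.cycle k (σ i))
  have hN : ∀ z, N z = ∑ i : Γ.QuiverVertex,
      Γ.trace k (ofPath k (Quiver.Path.nil : Quiver.Path i i) * z) • Γ.cycle k (σ i) := by
    intro z
    simp [N]
  have hmem : x ∈ (idealSubmodule (Γ.ideal k)).comap (LinearMap.id - N) := by
    refine mem_of_forall_coeff fun {i j} p hp => ?_
    rw [Submodule.mem_comap, mem_idealSubmodule, LinearMap.sub_apply, LinearMap.id_apply, hN]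
    have htr : ∀ l : Γ.QuiverVertex, l ≠ i →
        ofPath k (Quiver.Path.nil : Quiver.Path l l) * ofPath k p = 0 :=
      fun l hl => ofPath_mul_ofPath_of_ne k _ _ hl
    rw [Finset.sum_eq_single i (fun l _ hl => by rw [htr l hl, map_zero, zero_smul])
      (fun h => absurd (Finset.mem_univ i) h), ofPath_mul_ofPath, Quiver.Path.nil_comp]
    obtain h | h | h := extendable_or_isFull_or_mem_ideal (k := k) hmult σ hσ p
    · obtain ⟨y, hy⟩ := h.exists_trace_mul_eq_coeff (k := k)
      exact absurd ((hy x).symm.trans (hx y)) hp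
    · obtain ⟨α, hα, -, hc⟩ := exists_ofPath_eq_cycle (k := k) hmult h
      rw [trace_ofPath_of_isFull h, one_smul, ← hc]
      exact cycle_sub_cycle_mem_ideal hmult (hα.trans (hσ i).symm)
    · have h0 := trace_mul_eq_zero_of_mem_ideal hmult h
        (ofPath k (Quiver.Path.nil : Quiver.Path i i))
      rw [ofPath_mul_ofPath, Quiver.Path.nil_comp] at h0
      rw [h0, zero_smul, sub_zero]
      exact h
  rw [Submodule.mem_comap, mem_idealSubmodule, LinearMap.sub_apply, LinearMap.id_apply, hN] at hmem
  simpa [hx] using hmem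

/-- Outside the ideal a path is extendable or full, so it repeats no germ, and there are finitely
many such paths. -/
theorem finite_quotient (hmult : ∀ x, Γ.mult x = 1) (σ : Γ.QuiverVertex → Γ.Arrow)
    (hσ : ∀ i, (σ i).src = i) {K : TwoSidedIdeal (PathAlgebra k Γ.QuiverVertex)}
    (hK : Γ.ideal k ≤ K) : Module.Finite k (QuotientAlgebra K) := by
  classical
  let W : Set (QuiverPath Γ.QuiverVertex) := {p | (germs p.2.2).Nodup}
  have hW : Finite W := by
    refine Finite.of_injective (β := E × {l : List (E × Bool) // l.Nodup})
      (fun p => (p.1.1, ⟨germs p.1.2.2, p.2⟩)) ?_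
    rintro ⟨⟨i, j, p⟩, hp⟩ ⟨⟨i', j', p'⟩, hp'⟩ h
    obtain rfl : i = i' := congrArg Prod.fst h
    refine Subtype.ext (germs_injective p p' ?_)
    exact congrArg Subtype.val (congrArg Prod.snd h)
  let π := Ideal.Quotient.mkₐ k K.asIdeal
  refine Module.finite_def.2 (Submodule.fg_def.2
    ⟨Set.range fun p : W => π (ofPath k p.1.2.2), Set.finite_range _, ?_⟩)
  rw [eq_top_iff]
  intro x _
  obtain ⟨x, rfl⟩ := Ideal.Quotient.mkₐ_surjective k K.asIdeal x
  change x ∈ Submodule.comap π.toLinearMap (Submodule.span k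
    (Set.range fun p : W => π (ofPath k p.1.2.2)))
  refine mem_of_forall_coeff fun {i j} p _ => ?_
  have hnodup : (germs p).Nodup →
      ofPath k p ∈ Submodule.comap π.toLinearMap (Submodule.span k
        (Set.range fun p : W => π (ofPath k p.1.2.2))) := fun h =>
    Submodule.subset_span ⟨⟨⟨i, j, p⟩, h⟩, rfl⟩
  obtain ⟨q, -, h⟩ | h | h := extendable_or_isFull_or_mem_ideal (k := k) hmult σ hσ p
  · exact hnodup (List.nodup_append.1 h.nodup).2.1
  · exact hnodup h.nodup
  · have h0 : π (ofPath k p) = 0 := Ideal.Quotient.eq_zero_iff_mem.2 (hK h)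
    rw [Submodule.mem_comap, AlgHom.toLinearMap_apply, h0]
    exact Submodule.zero_mem _

end BrauerGraph

/-! ### The cut-free part and the ideal of the cut. -/

namespace BrauerGraph

open PathAlgebra

variable {V : Type v} {E : Type u} {Γ : BrauerGraph V E}

/-- A germ is cut if its arrow belongs to the given set of arrows. -/
def IsCut (D : Set Γ.Arrow) (g : E × Bool) : Prop :=
  ∃ h : ¬ Γ.Truncated g, (⟨g, h⟩ : Γ.Arrow) ∈ D

/-- A path is cut-free if none of its arrows belongs to the given set of arrows. -/
def CutFree (D : Set Γ.Arrow) {i j : Γ.QuiverVertex} (p : Quiver.Path i j) : Prop :=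
  ∀ g ∈ germs p, ¬ IsCut D g

theorem cutFree_comp {D : Set Γ.Arrow} {i j l : Γ.QuiverVertex} {p : Quiver.Path i j}
    {q : Quiver.Path j l} : CutFree D (p.comp q) ↔ CutFree D p ∧ CutFree D q := by
  simp only [CutFree, germs_comp, List.mem_append, or_imp, forall_and]

theorem cutFree_nil (D : Set Γ.Arrow) (i : Γ.QuiverVertex) :
    CutFree D (Quiver.Path.nil : Quiver.Path i i) := by
  simp [CutFree]

open Classical in
/-- The linear projection of the path algebra onto the span of the cut-free paths. -/
noncomputable def cutFreeLin (k : Type w) [Field k] (D : Set Γ.Arrow) :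
    PathAlgebra k Γ.QuiverVertex →ₗ[k] PathAlgebra k Γ.QuiverVertex :=
  (Finsupp.linearCombination k (fun p : QuiverPath Γ.QuiverVertex =>
    if CutFree D p.2.2 then ofPath k p.2.2 else 0))

variable {k : Type w} [Field k] {D : Set Γ.Arrow}

theorem cutFreeLin_of_cutFree {i j : Γ.QuiverVertex} {p : Quiver.Path i j} (h : CutFree D p) :
    cutFreeLin k D (ofPath k p) = ofPath k p := by
  refine (Finsupp.linearCombination_single k 1 _).trans ?_
  rw [one_smul, if_pos h]

theorem cutFreeLin_of_not_cutFree {i j : Γ.QuiverVertex} {p : Quiver.Path i j}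
    (h : ¬ CutFree D p) : cutFreeLin k D (ofPath k p) = 0 := by
  refine (Finsupp.linearCombination_single k 1 _).trans ?_
  rw [one_smul, if_neg h]

variable [Fintype E]

theorem IsCuttingSet.exists_isCut (hD : Γ.IsCuttingSet D) (hmult : ∀ x, Γ.mult x = 1)
    {l : List (E × Bool)} (hl : Γ.IsFull l) : ∃ g ∈ l, IsCut D g := by
  obtain ⟨h, hh, rfl⟩ := id hl
  have hh' : ¬ Γ.Truncated h := fun h' => hh ((truncated_iff hmult h).1 h')
  obtain ⟨α, ⟨hα, hv⟩, -⟩ := hD (Γ.endpoint h) ⟨⟨h, hh'⟩, rfl⟩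
  obtain ⟨m, hm⟩ := exists_germCycle_eq_cons hh
  refine ⟨α.1, ?_, α.2, hα⟩
  rw [hl.mem_iff (g := h) (by rw [hm]; exact List.mem_cons_self)]
  exact hv.symm

theorem IsCuttingSet.eq_of_isCut (hD : Γ.IsCuttingSet D)
    {l : List (E × Bool)} (hl : Γ.IsFull l) {g g' : E × Bool} (hg : g ∈ l) (hg' : g' ∈ l)
    (h : IsCut D g) (h' : IsCut D g') : g = g' := by
  obtain ⟨h, hd⟩ := h
  obtain ⟨h', hd'⟩ := h'
  exact congrArg Subtype.val ((hD (Γ.endpoint g) ⟨⟨g, h⟩, rfl⟩).unique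
    ⟨hd, rfl⟩ ⟨hd', ((hl.mem_iff hg).1 hg').symm⟩)

theorem cutFreeLin_mul (x y : PathAlgebra k Γ.QuiverVertex) :
    cutFreeLin k D (x * y) = cutFreeLin k D x * cutFreeLin k D y := by
  induction x using PathAlgebra.induction_on with
  | zero => simp
  | add x x' h h' => rw [add_mul, map_add, map_add, h, h', add_mul]
  | smul c x h => rw [smul_mul_assoc, map_smul, map_smul, h, smul_mul_assoc]
  | @path a b p =>
  induction y using PathAlgebra.induction_on with
  | zero => simp
  | add x x' h h' => rw [mul_add, map_add, map_add, h, h', mul_add]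
  | smul c x h => rw [mul_smul_comm, map_smul, map_smul, h, mul_smul_comm]
  | @path c d q =>
  by_cases hbc : b = c
  · subst hbc
    rw [ofPath_mul_ofPath]
    by_cases hp : CutFree D p
    · by_cases hq : CutFree D q
      · rw [cutFreeLin_of_cutFree hp, cutFreeLin_of_cutFree hq,
          cutFreeLin_of_cutFree (cutFree_comp.2 ⟨hp, hq⟩), ofPath_mul_ofPath]
      · rw [cutFreeLin_of_not_cutFree hq, mul_zero,
          cutFreeLin_of_not_cutFree fun h => hq (cutFree_comp.1 h).2]
    · rw [cutFreeLin_of_not_cutFree hp, zero_mul,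
        cutFreeLin_of_not_cutFree fun h => hp (cutFree_comp.1 h).1]
  · rw [ofPath_mul_ofPath_of_ne k _ _ hbc, map_zero]
    by_cases hp : CutFree D p
    · by_cases hq : CutFree D q
      · rw [cutFreeLin_of_cutFree hp, cutFreeLin_of_cutFree hq,
          ofPath_mul_ofPath_of_ne k _ _ hbc]
      · rw [cutFreeLin_of_not_cutFree hq, mul_zero]
    · rw [cutFreeLin_of_not_cutFree hp, zero_mul]

/-- The endomorphism of the path algebra that sends the arrows of `D` to zero and fixes the other
arrows. -/
noncomputable def cutFreePart (k : Type w) [Field k] (D : Set Γ.Arrow) :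
    PathAlgebra k Γ.QuiverVertex →ₐ[k] PathAlgebra k Γ.QuiverVertex :=
  AlgHom.ofLinearMap (cutFreeLin k D)
    (by
      rw [one_def, map_sum]
      exact Finset.sum_congr rfl fun i _ => cutFreeLin_of_cutFree (cutFree_nil D i))
    cutFreeLin_mul

theorem cutFreePart_of_cutFree {i j : Γ.QuiverVertex} {p : Quiver.Path i j} (h : CutFree D p) :
    cutFreePart k D (ofPath k p) = ofPath k p :=
  cutFreeLin_of_cutFree h

theorem cutFreePart_of_not_cutFree {i j : Γ.QuiverVertex} {p : Quiver.Path i j}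
    (h : ¬ CutFree D p) : cutFreePart k D (ofPath k p) = 0 :=
  cutFreeLin_of_not_cutFree h

theorem cutFreePart_cutFreePart (x : PathAlgebra k Γ.QuiverVertex) :
    cutFreePart k D (cutFreePart k D x) = cutFreePart k D x := by
  induction x using PathAlgebra.induction_on with
  | zero => simp
  | add x x' h h' => rw [map_add, map_add, h, h']
  | smul c x h => rw [map_smul, map_smul, h]
  | @path a b p =>
  by_cases hp : CutFree D p
  · rw [cutFreePart_of_cutFree hp, cutFreePart_of_cutFree hp]
  · rw [cutFreePart_of_not_cutFree hp, map_zero]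

/-- Every full path meets `D` at least once. -/
theorem trace_cutFreePart (hD : Γ.IsCuttingSet D) (hmult : ∀ x, Γ.mult x = 1)
    (x : PathAlgebra k Γ.QuiverVertex) : Γ.trace k (cutFreePart k D x) = 0 := by
  induction x using PathAlgebra.induction_on with
  | zero => simp
  | add x x' h h' => rw [map_add, map_add, h, h', add_zero]
  | smul c x h => rw [map_smul, map_smul, h, smul_zero]
  | @path a b p =>
  by_cases hp : CutFree D p
  · rw [cutFreePart_of_cutFree hp, trace_ofPath_of_not_isFull]
    intro h
    obtain ⟨g, hg, hc⟩ := hD.exists_isCut hmult h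
    exact hp g hg hc
  · rw [cutFreePart_of_not_cutFree hp, map_zero]

/-- Every full path meets `D` at most once, so it is not a product of two paths that both meet `D`.
-/
theorem trace_sub_cutFreePart_mul (hD : Γ.IsCuttingSet D) (x y : PathAlgebra k Γ.QuiverVertex) :
    Γ.trace k ((x - cutFreePart k D x) * (y - cutFreePart k D y)) = 0 := by
  induction x using PathAlgebra.induction_on with
  | zero => simp
  | add x x' h h' => rw [map_add, add_sub_add_comm, add_mul, map_add, h, h', add_zero]
  | smul c x h => rw [map_smul, ← smul_sub, smul_mul_assoc, map_smul, h, smul_zero]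
  | @path a b p =>
  induction y using PathAlgebra.induction_on with
  | zero => simp
  | add x x' h h' => rw [map_add, add_sub_add_comm, mul_add, map_add, h, h', add_zero]
  | smul c x h => rw [map_smul, ← smul_sub, mul_smul_comm, map_smul, h, smul_zero]
  | @path c d q =>
  by_cases hp : CutFree D p
  · rw [cutFreePart_of_cutFree hp, sub_self, zero_mul, map_zero]
  by_cases hq : CutFree D q
  · rw [cutFreePart_of_cutFree hq, sub_self, mul_zero, map_zero]
  rw [cutFreePart_of_not_cutFree hp, cutFreePart_of_not_cutFree hq, sub_zero, sub_zero]
  by_cases hbc : b = c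
  · subst hbc
    rw [ofPath_mul_ofPath, trace_ofPath_of_not_isFull]
    intro h
    rw [germs_comp] at h
    simp only [CutFree, not_forall, not_not] at hp hq
    obtain ⟨g, hg, hc⟩ := hp
    obtain ⟨g', hg', hc'⟩ := hq
    exact (List.nodup_append.1 h.nodup).2.2 g hg g' hg' (hD.eq_of_isCut h
      (List.mem_append_left _ hg) (List.mem_append_right _ hg') hc hc')
  · rw [ofPath_mul_ofPath_of_ne k _ _ hbc, map_zero]

theorem ideal_le_cutIdeal (k : Type w) [Field k] (D : Set Γ.Arrow) :
    Γ.ideal k ≤ Γ.cutIdeal k D :=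
  fun _ hx => TwoSidedIdeal.subset_span (Or.inl hx)

theorem ofPath_mem_cutIdeal {i j : Γ.QuiverVertex} {p : Quiver.Path i j} (hp : ¬ CutFree D p) :
    ofPath k p ∈ Γ.cutIdeal k D := by
  induction p with
  | nil => exact absurd (cutFree_nil D _) hp
  | cons p f ih =>
    rw [ofPath_cons]
    by_cases h : CutFree D p
    · refine TwoSidedIdeal.mul_mem_left _ _ _ (TwoSidedIdeal.subset_span (Or.inr ?_))
      simp only [CutFree, germs_cons, List.mem_append, List.mem_singleton, not_forall,
        not_not] at hp
      obtain ⟨g, hg, hc⟩ := hp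
      obtain hg | rfl := hg
      · exact absurd hc (h g hg)
      · obtain ⟨h1, h2⟩ := hc
        exact ⟨_, h2, (ofArrow_eq k f).symm⟩
    · exact TwoSidedIdeal.mul_mem_right _ _ _ (ih h)

theorem sub_cutFreePart_mem_cutIdeal (x : PathAlgebra k Γ.QuiverVertex) :
    x - cutFreePart k D x ∈ Γ.cutIdeal k D := by
  suffices h : x ∈ (idealSubmodule (Γ.cutIdeal k D)).comap
      (LinearMap.id - (cutFreePart k D).toLinearMap) from h
  refine mem_of_forall_coeff fun p _ => ?_
  change ofPath k p - cutFreePart k D (ofPath k p) ∈ Γ.cutIdeal k D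
  by_cases hp : CutFree D p
  · rw [cutFreePart_of_cutFree hp, sub_self]
    exact TwoSidedIdeal.zero_mem _
  · rw [cutFreePart_of_not_cutFree hp, sub_zero]
    exact ofPath_mem_cutIdeal hp

/-- The projection kills every vertex cycle and fixes or kills each arrow, so it maps the relations
into the ideal, and it kills `D`. Conversely, `x` differs from its projection by paths through `D`.
-/
theorem mem_cutIdeal_iff (hD : Γ.IsCuttingSet D) (hmult : ∀ x, Γ.mult x = 1)
    {x : PathAlgebra k Γ.QuiverVertex} :
    x ∈ Γ.cutIdeal k D ↔ cutFreePart k D x ∈ Γ.ideal k := by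
  constructor
  · have hcyc : ∀ α : Γ.Arrow, cutFreePart k D (Γ.cycle k α) = 0 := by
      intro α
      refine cutFreePart_of_not_cutFree fun h => ?_
      obtain ⟨g, hg, hc⟩ := hD.exists_isCut hmult (isFull_walk hmult α)
      exact h g hg hc
    have harr : ∀ α : Γ.Arrow, cutFreePart k D (ofArrow k α.hom) = ofArrow k α.hom ∨
        cutFreePart k D (ofArrow k α.hom) = 0 := fun α =>
      (em (CutFree D α.hom.toPath)).imp cutFreePart_of_cutFree cutFreePart_of_not_cutFree
    have h1 : Γ.ideal k ≤ (Γ.ideal k).comap (cutFreePart k D) := by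
      refine TwoSidedIdeal.span_le.2 fun r hr => ?_
      rw [SetLike.mem_coe, TwoSidedIdeal.mem_comap]
      obtain (⟨α, β, hαβ, rfl⟩ | ⟨α, -, rfl⟩) | ⟨α, β, hαβ, hne, rfl⟩ := id hr
      · rw [hmult, hmult, pow_one, pow_one, map_sub, hcyc, hcyc, sub_zero]
        exact TwoSidedIdeal.zero_mem _
      · rw [hmult, pow_one, map_mul, hcyc, zero_mul]
        exact TwoSidedIdeal.zero_mem _
      · rw [map_mul]
        obtain h | h := harr α
        · obtain h' | h' := harr β
          · rw [h, h']
            exact TwoSidedIdeal.subset_span hr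
          · rw [h', mul_zero]
            exact TwoSidedIdeal.zero_mem _
        · rw [h, zero_mul]
          exact TwoSidedIdeal.zero_mem _
    suffices h2 : Γ.cutIdeal k D ≤ (Γ.ideal k).comap (cutFreePart k D) from
      fun hx => (TwoSidedIdeal.mem_comap _).1 (h2 hx)
    refine TwoSidedIdeal.span_le.2 (Set.union_subset h1 ?_)
    rintro _ ⟨α, hα, rfl⟩
    rw [SetLike.mem_coe, TwoSidedIdeal.mem_comap]
    have h0 : cutFreePart k D (ofArrow k α.hom) = 0 :=
      cutFreePart_of_not_cutFree fun h => h α.1 (by simp) ⟨α.2, hα⟩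
    rw [h0]
    exact TwoSidedIdeal.zero_mem _
  · intro h
    rw [← sub_add_cancel x (cutFreePart k D x)]
    exact TwoSidedIdeal.add_mem _ (sub_cutFreePart_mem_cutIdeal x) (ideal_le_cutIdeal k D h)

end BrauerGraph

/-! ### The isomorphism with the trivial extension. -/

namespace BrauerGraph

open PathAlgebra

variable {V : Type v} {E : Type u} {Γ : BrauerGraph V E} [Fintype E] {k : Type w} [Field k]
  {D : Set Γ.Arrow}

/-- This is the product rule in the second component of the trivial extension. It comes from
expanding `tr((π(a)x - π(a)π(x))(y - π(y))) = 0`, where the term with three projections vanishes. -/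
theorem trace_cutFreePart_mul_mul (hD : Γ.IsCuttingSet D) (hmult : ∀ x, Γ.mult x = 1)
    (a x y : PathAlgebra k Γ.QuiverVertex) :
    Γ.trace k (cutFreePart k D a * (x * y)) =
      Γ.trace k (cutFreePart k D (a * x) * y) + Γ.trace k (cutFreePart k D (y * a) * x) := by
  have h1 := trace_sub_cutFreePart_mul hD (cutFreePart k D a * x) y
  have h2 : ∀ z, Γ.trace k (cutFreePart k D z) = 0 := trace_cutFreePart (k := k) hD hmult
  have h3 : Γ.trace k (cutFreePart k D a * cutFreePart k D x * cutFreePart k D y) = 0 := by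
    rw [← map_mul, ← map_mul, h2]
  have h4 : Γ.trace k (cutFreePart k D y * cutFreePart k D a * x) =
      Γ.trace k (cutFreePart k D a * x * cutFreePart k D y) := by
    rw [mul_assoc, trace_mul_comm]
  rw [map_mul (cutFreePart k D), cutFreePart_cutFreePart, mul_sub, sub_mul, sub_mul, map_sub,
    map_sub, map_sub, h3] at h1
  rw [map_mul (cutFreePart k D), map_mul (cutFreePart k D), h4, ← mul_assoc]
  linear_combination h1

/-- The pairing of the admissible cut with the path algebra: the class of `a` and `x` are sent to
the trace of the product of the cut-free part of `a` and `x`. -/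
noncomputable def cutPairing (k : Type w) [Field k] (hD : Γ.IsCuttingSet D)
    (hmult : ∀ x, Γ.mult x = 1) :
    Γ.admissibleCut k D →ₗ[k] PathAlgebra k Γ.QuiverVertex →ₗ[k] k :=
  (((Γ.cutIdeal k D).asIdeal.restrictScalars k).liftQ
    (((LinearMap.mul k (PathAlgebra k Γ.QuiverVertex)).compr₂ (Γ.trace k)) ∘ₗ
      (cutFreePart k D).toLinearMap)
    (fun a ha => LinearMap.mem_ker.2 (LinearMap.ext fun x => by
      have h := (mem_cutIdeal_iff hD hmult).1 ha
      change Γ.trace k (cutFreePart k D a * x) = 0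
      rw [trace_mul_comm]
      exact trace_mul_eq_zero_of_mem_ideal hmult h x))) ∘ₗ
    (Submodule.Quotient.restrictScalarsEquiv k (Γ.cutIdeal k D).asIdeal).symm.toLinearMap

variable (hD : Γ.IsCuttingSet D) (hmult : ∀ x, Γ.mult x = 1)

/-- The linear map from the path algebra to the dual of the admissible cut. -/
noncomputable def toDualCut (k : Type w) [Field k] (hD : Γ.IsCuttingSet D)
    (hmult : ∀ x, Γ.mult x = 1) :
    PathAlgebra k Γ.QuiverVertex →ₗ[k] DualBimodule k (Γ.admissibleCut k D) :=
  (cutPairing k hD hmult).flip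

theorem toDualCut_apply (x a : PathAlgebra k Γ.QuiverVertex) :
    (toDualCut k hD hmult x).lin (Ideal.Quotient.mkₐ k (Γ.cutIdeal k D).asIdeal a) =
      Γ.trace k (cutFreePart k D a * x) :=
  rfl

theorem dualBimodule_ext {f g : DualBimodule k (Γ.admissibleCut k D)}
    (h : ∀ a, f.lin (Ideal.Quotient.mkₐ k (Γ.cutIdeal k D).asIdeal a) =
      g.lin (Ideal.Quotient.mkₐ k (Γ.cutIdeal k D).asIdeal a)) : f = g :=
  LinearMap.ext fun a => by
    obtain ⟨a, rfl⟩ := Ideal.Quotient.mkₐ_surjective k (Γ.cutIdeal k D).asIdeal a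
    exact h a

/-- The linear map from the path algebra to the trivial extension of the admissible cut. -/
noncomputable def toTrivialExtensionLin (k : Type w) [Field k] (hD : Γ.IsCuttingSet D)
    (hmult : ∀ x, Γ.mult x = 1) :
    PathAlgebra k Γ.QuiverVertex →ₗ[k] TrivialExtension k (Γ.admissibleCut k D) where
  toFun x := TrivSqZeroExt.inl (Ideal.Quotient.mkₐ k (Γ.cutIdeal k D).asIdeal x) +
    TrivSqZeroExt.inr (toDualCut k hD hmult x)
  map_add' x y := TrivSqZeroExt.ext (by simp) (by simp)
  map_smul' c x := TrivSqZeroExt.ext (by simp) (by simp)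

theorem fst_toTrivialExtensionLin (x : PathAlgebra k Γ.QuiverVertex) :
    (toTrivialExtensionLin k hD hmult x).fst =
      Ideal.Quotient.mkₐ k (Γ.cutIdeal k D).asIdeal x := by
  simp [toTrivialExtensionLin]

theorem snd_toTrivialExtensionLin (x : PathAlgebra k Γ.QuiverVertex) :
    (toTrivialExtensionLin k hD hmult x).snd = toDualCut k hD hmult x := by
  simp [toTrivialExtensionLin]

/-- The algebra homomorphism from the path algebra to the trivial extension of the admissible
cut. -/
noncomputable def toTrivialExtension (k : Type w) [Field k] (hD : Γ.IsCuttingSet D)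
    (hmult : ∀ x, Γ.mult x = 1) :
    PathAlgebra k Γ.QuiverVertex →ₐ[k] TrivialExtension k (Γ.admissibleCut k D) :=
  AlgHom.ofLinearMap (toTrivialExtensionLin k hD hmult)
    (by
      refine TrivSqZeroExt.ext ?_ ?_
      · rw [fst_toTrivialExtensionLin, map_one, TrivSqZeroExt.fst_one]
      · rw [snd_toTrivialExtensionLin, TrivSqZeroExt.snd_one]
        refine dualBimodule_ext fun a => ?_
        rw [toDualCut_apply, mul_one, trace_cutFreePart hD hmult]
        rfl)
    (fun x y => by
      refine TrivSqZeroExt.ext ?_ ?_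
      · rw [TrivSqZeroExt.fst_mul, fst_toTrivialExtensionLin, fst_toTrivialExtensionLin,
          fst_toTrivialExtensionLin, map_mul]
      · rw [TrivSqZeroExt.snd_mul, snd_toTrivialExtensionLin, snd_toTrivialExtensionLin,
          snd_toTrivialExtensionLin, fst_toTrivialExtensionLin, fst_toTrivialExtensionLin]
        refine dualBimodule_ext fun a => ?_
        exact trace_cutFreePart_mul_mul hD hmult a x y)

-- For `x` in `J`, the product of `a - π(a)` with `π(x)`, which lies in `I`, and with `x - π(x)` has
-- trace zero. Hence `tr(ax) = tr(π(a)x)`, and the vanishing of the dual component puts `x` in the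
-- radical.
variable {hD hmult} in
theorem toTrivialExtension_eq_zero_iff (σ : Γ.QuiverVertex → Γ.Arrow) (hσ : ∀ i, (σ i).src = i)
    {x : PathAlgebra k Γ.QuiverVertex} :
    toTrivialExtension k hD hmult x = 0 ↔ x ∈ Γ.ideal k := by
  have hcut : ∀ x, Ideal.Quotient.mkₐ k (Γ.cutIdeal k D).asIdeal x = 0 ↔ x ∈ Γ.cutIdeal k D :=
    fun x => Ideal.Quotient.eq_zero_iff_mem
  rw [TrivSqZeroExt.ext_iff]
  change (toTrivialExtensionLin k hD hmult x).fst = 0 ∧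
    (toTrivialExtensionLin k hD hmult x).snd = 0 ↔ _
  rw [fst_toTrivialExtensionLin, snd_toTrivialExtensionLin, hcut]
  constructor
  · rintro ⟨hx, h0⟩
    refine mem_ideal_of_trace_mul_eq_zero hmult σ hσ fun a => ?_
    have h1 : Γ.trace k (cutFreePart k D a * x) = 0 := by
      rw [← toDualCut_apply hD hmult, h0]
      rfl
    have h2 := trace_sub_cutFreePart_mul hD a x
    have h3 := trace_mul_eq_zero_of_mem_ideal hmult ((mem_cutIdeal_iff hD hmult).1 hx)
      (a - cutFreePart k D a)
    rw [mul_sub, map_sub, h3, sub_zero, sub_mul, map_sub, h1, sub_zero] at h2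
    exact h2
  · intro hx
    refine ⟨ideal_le_cutIdeal k D hx, dualBimodule_ext fun a => ?_⟩
    rw [toDualCut_apply]
    exact trace_mul_eq_zero_of_mem_ideal hmult hx _

/-- The forms given by elements of `J` already exhaust the dual. They can therefore correct the
second component of any lift without changing the first. -/
theorem toTrivialExtension_surjective (σ : Γ.QuiverVertex → Γ.Arrow) (hσ : ∀ i, (σ i).src = i) :
    Function.Surjective (toTrivialExtension k hD hmult) := by
  have hfin : Module.Finite k (Γ.admissibleCut k D) :=
    finite_quotient hmult σ hσ (ideal_le_cutIdeal k D)
  let W : Submodule k (Module.Dual k (Γ.admissibleCut k D)) :=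
    (idealSubmodule (Γ.cutIdeal k D)).map (cutPairing k hD hmult).flip
  have hW : W = ⊤ := by
    -- In finite dimension it suffices that no nonzero class `a` is killed by `W`. Testing `a` on `x
    -- - π(x)` gives `tr(π(a)x) = 0` for all `x`.
    rw [← Subspace.dualCoannihilator_dualAnnihilator_eq (W := W),
      Submodule.dualAnnihilator_eq_top_iff, eq_bot_iff]
    intro a ha
    obtain ⟨a, rfl⟩ := Ideal.Quotient.mkₐ_surjective k (Γ.cutIdeal k D).asIdeal a
    rw [Submodule.mem_dualCoannihilator] at ha
    refine (Submodule.mem_bot k).2 (Ideal.Quotient.eq_zero_iff_mem.2 ?_)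
    refine (mem_cutIdeal_iff hD hmult).2 (mem_ideal_of_trace_mul_eq_zero hmult σ hσ fun x => ?_)
    have h1 : Γ.trace k (cutFreePart k D a * (x - cutFreePart k D x)) = 0 :=
      ha _ (Submodule.mem_map_of_mem (sub_cutFreePart_mem_cutIdeal x))
    rw [mul_sub, map_sub, ← map_mul (cutFreePart k D), trace_cutFreePart hD hmult, sub_zero] at h1
    rw [trace_mul_comm, h1]
  intro t
  obtain ⟨a, ha⟩ := Ideal.Quotient.mkₐ_surjective k (Γ.cutIdeal k D).asIdeal t.fst
  have hdual : ∀ f : DualBimodule k (Γ.admissibleCut k D),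
      ∃ x ∈ Γ.cutIdeal k D, toDualCut k hD hmult x = f := fun f => by
    have hf : f.lin ∈ W := hW ▸ Submodule.mem_top
    exact hf
  obtain ⟨x, hx, hxt⟩ := hdual (t.snd - toDualCut k hD hmult a)
  have hx0 : Ideal.Quotient.mkₐ k (Γ.cutIdeal k D).asIdeal x = 0 :=
    Ideal.Quotient.eq_zero_iff_mem.2 hx
  refine ⟨a + x, TrivSqZeroExt.ext ?_ ?_⟩
  · change (toTrivialExtensionLin k hD hmult (a + x)).fst = _
    rw [fst_toTrivialExtensionLin, map_add, hx0, add_zero, ha]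
  · change (toTrivialExtensionLin k hD hmult (a + x)).snd = _
    rw [snd_toTrivialExtensionLin, map_add, hxt, add_sub_cancel]

/-- The trivial extension of an admissible cut is the Brauer graph algebra. -/
noncomputable def trivialExtensionEquiv (k : Type w) [Field k] (hD : Γ.IsCuttingSet D)
    (hmult : ∀ x, Γ.mult x = 1) (σ : Γ.QuiverVertex → Γ.Arrow) (hσ : ∀ i, (σ i).src = i) :
    TrivialExtension k (Γ.admissibleCut k D) ≃ₐ[k] Γ.algebra k :=
  ((Ideal.quotientEquivAlgOfEq k (Ideal.ext fun x => by
      rw [RingHom.mem_ker]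
      exact (toTrivialExtension_eq_zero_iff σ hσ).symm)).trans
    (Ideal.quotientKerAlgEquivOfSurjective
      (toTrivialExtension_surjective hD hmult σ hσ))).symm

end BrauerGraph

/-! ### The gentle presentation of the cut. -/

namespace BrauerGraph

open PathAlgebra

variable {V : Type v} {E : Type u} {Γ : BrauerGraph V E}

/-- The vertex set of the quiver that is obtained by deleting a set of arrows. -/
def CutQuiver (_D : Set Γ.Arrow) : Type u := E

instance [Fintype E] (D : Set Γ.Arrow) : Fintype (CutQuiver D) := inferInstanceAs (Fintype E)

instance (D : Set Γ.Arrow) : Quiver.{u} (CutQuiver D) where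
  Hom i j := {h : E × Bool // (∃ hh : ¬ Γ.Truncated h, (⟨h, hh⟩ : Γ.Arrow) ∉ D) ∧
    h.1 = i ∧ (Γ.next h).1 = j}

instance [Finite E] (D : Set Γ.Arrow) (i j : CutQuiver D) : Finite (i ⟶ j) :=
  inferInstanceAs (Finite {_h : E × Bool // _})

/-- The inclusion of the quiver without the arrows of `D`. -/
def cutIncl (D : Set Γ.Arrow) : CutQuiver D ⥤q Γ.QuiverVertex where
  obj i := i
  map f := ⟨f.1, f.2.1.1, f.2.2⟩

variable {D : Set Γ.Arrow}

/-- The germ of an arrow that is not deleted. -/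
def cutGerm {i j : CutQuiver D} (f : i ⟶ j) : E × Bool := homGerm ((cutIncl D).map f)

theorem not_isCut_cutGerm {i j : CutQuiver D} (f : i ⟶ j) : ¬ IsCut D (cutGerm f) := by
  obtain ⟨f, ⟨h1, h2⟩, h3⟩ := f
  rintro ⟨h, h'⟩
  exact h2 h'

theorem cutGerm_fst {i j : CutQuiver D} (f : i ⟶ j) : (cutGerm f).1 = i :=
  homGerm_fst ((cutIncl D).map f)

theorem next_cutGerm_fst {i j : CutQuiver D} (f : i ⟶ j) : (Γ.next (cutGerm f)).1 = j :=
  next_homGerm_fst ((cutIncl D).map f)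

theorem eq_of_cutGerm_eq {i j i' j' : CutQuiver D} (f : i ⟶ j) (g : i' ⟶ j')
    (h : cutGerm f = cutGerm g) :
    (⟨i, j, f⟩ : Σ i j : CutQuiver D, (i ⟶ j)) = ⟨i', j', g⟩ := by
  obtain ⟨f, h1, rfl, rfl⟩ := f
  obtain ⟨g, h2, rfl, rfl⟩ := g
  obtain rfl : f = g := h
  rfl

theorem sigma_target_eq {i j j' : CutQuiver D} (f : i ⟶ j) (g : i ⟶ j')
    (h : cutGerm f = cutGerm g) :
    (⟨j, f⟩ : Σ j : CutQuiver D, (i ⟶ j)) = ⟨j', g⟩ := by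
  cases eq_of_cutGerm_eq f g h
  rfl

theorem sigma_source_eq {i i' j : CutQuiver D} (f : i ⟶ j) (g : i' ⟶ j)
    (h : cutGerm f = cutGerm g) :
    (⟨i, f⟩ : Σ i : CutQuiver D, (i ⟶ j)) = ⟨i', g⟩ := by
  cases eq_of_cutGerm_eq f g h
  rfl

theorem germs_mapPath {i j : CutQuiver D} (p : Quiver.Path i j) :
    germs ((cutIncl D).mapPath p) = p.labels (fun {_ _} f => cutGerm f) := by
  induction p with
  | nil => rfl
  | cons p f ih => exact congrArg (· ++ [cutGerm f]) ih

theorem cutFree_mapPath {i j : CutQuiver D} (p : Quiver.Path i j) :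
    CutFree D ((cutIncl D).mapPath p) := by
  induction p with
  | nil => exact cutFree_nil D _
  | cons p f ih =>
    intro g hg
    obtain hg | hg := List.mem_append.1 hg
    · exact ih g hg
    · rw [List.mem_singleton.1 hg]
      exact not_isCut_cutGerm f

theorem mapPath_injective {i j i' j' : CutQuiver D} (p : Quiver.Path i j)
    (p' : Quiver.Path i' j')
    (h : (⟨_, _, (cutIncl D).mapPath p⟩ : QuiverPath Γ.QuiverVertex) =
      ⟨_, _, (cutIncl D).mapPath p'⟩) :
    (⟨i, j, p⟩ : QuiverPath (CutQuiver D)) = ⟨i', j', p'⟩ := by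
  obtain rfl : i = i' := congrArg Sigma.fst h
  refine Quiver.Path.labels_injective (fun {_ _} f => cutGerm f) ?_ p p' ?_
  · exact fun f g => eq_of_cutGerm_eq f g
  · rw [← germs_mapPath, ← germs_mapPath]
    exact congrArg (fun p : QuiverPath Γ.QuiverVertex => germs p.2.2) h

theorem CutFree.exists_mapPath_eq {i : CutQuiver D} {j : Γ.QuiverVertex}
    (p : Quiver.Path ((cutIncl D).obj i) j) (hp : CutFree D p) :
    ∃ (j' : CutQuiver D) (p' : Quiver.Path i j'),
      (⟨_, _, (cutIncl D).mapPath p'⟩ : QuiverPath Γ.QuiverVertex) = ⟨_, _, p⟩ := by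
  induction p with
  | nil => exact ⟨i, .nil, rfl⟩
  | @cons j l p f ih =>
    obtain ⟨j', p', h⟩ := ih fun g hg => hp g (List.mem_append_left _ hg)
    obtain ⟨f, h1, h2, h3⟩ := f
    have hf : (⟨f, h1⟩ : Γ.Arrow) ∉ D := fun hd =>
      hp f (List.mem_append_right _ (List.mem_singleton.2 rfl)) ⟨h1, hd⟩
    cases h
    exact ⟨l, p'.cons ⟨f, ⟨h1, hf⟩, h2, h3⟩, rfl⟩

section Algebra

variable [Fintype E] {k : Type w} [Field k]

/-- The inclusion of the path algebra of the quiver without the arrows of `D`, as a linear map. -/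
noncomputable def cutInclLin (k : Type w) [Field k] (D : Set Γ.Arrow) :
    PathAlgebra k (CutQuiver D) →ₗ[k] PathAlgebra k Γ.QuiverVertex :=
  (Finsupp.linearCombination k (fun p : QuiverPath (CutQuiver D) =>
    ofPath k ((cutIncl D).mapPath p.2.2)))

theorem cutInclLin_ofPath {i j : CutQuiver D} (p : Quiver.Path i j) :
    cutInclLin k D (ofPath k p) = ofPath k ((cutIncl D).mapPath p) :=
  (Finsupp.linearCombination_single k 1 _).trans (one_smul k _)

/-- The inclusion of the path algebra of the quiver without the arrows of `D`. -/
noncomputable def cutInclAlgHom (k : Type w) [Field k] (D : Set Γ.Arrow) :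
    PathAlgebra k (CutQuiver D) →ₐ[k] PathAlgebra k Γ.QuiverVertex :=
  AlgHom.ofLinearMap (cutInclLin k D)
    (by
      rw [one_def, one_def, map_sum]
      exact Finset.sum_congr rfl fun i _ => cutInclLin_ofPath _)
    (fun x y => by
      induction x using PathAlgebra.induction_on with
      | zero => simp
      | add x x' h h' => rw [add_mul, map_add, map_add, h, h', add_mul]
      | smul c x h => rw [smul_mul_assoc, map_smul, map_smul, h, smul_mul_assoc]
      | @path a b p =>
      induction y using PathAlgebra.induction_on with
      | zero => simp
      | add x x' h h' => rw [mul_add, map_add, map_add, h, h', mul_add]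
      | smul c x h => rw [mul_smul_comm, map_smul, map_smul, h, mul_smul_comm]
      | @path c d q =>
      rw [cutInclLin_ofPath, cutInclLin_ofPath]
      by_cases hbc : b = c
      · subst hbc
        rw [ofPath_mul_ofPath, ofPath_mul_ofPath, cutInclLin_ofPath, Prefunctor.mapPath_comp]
      · rw [ofPath_mul_ofPath_of_ne k _ _ hbc, map_zero]
        exact (ofPath_mul_ofPath_of_ne (Q := Γ.QuiverVertex) k _ _ hbc).symm)

theorem cutInclAlgHom_ofPath {i j : CutQuiver D} (p : Quiver.Path i j) :
    cutInclAlgHom k D (ofPath k p) = ofPath k ((cutIncl D).mapPath p) :=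
  cutInclLin_ofPath p

theorem cutInclAlgHom_ofArrow {i j : CutQuiver D} (f : i ⟶ j) :
    cutInclAlgHom k D (ofArrow k f) = ofArrow k ((cutIncl D).map f) :=
  cutInclLin_ofPath f.toPath

theorem cutFreePart_cutInclAlgHom (x : PathAlgebra k (CutQuiver D)) :
    cutFreePart k D (cutInclAlgHom k D x) = cutInclAlgHom k D x := by
  induction x using PathAlgebra.induction_on with
  | zero => simp
  | add x x' h h' => rw [map_add, map_add, h, h']
  | smul c x h => rw [map_smul, map_smul, h]
  | path p => rw [cutInclAlgHom_ofPath, cutFreePart_of_cutFree (cutFree_mapPath p)]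

theorem coeff_cutInclAlgHom {i j : CutQuiver D} (p : Quiver.Path i j)
    (x : PathAlgebra k (CutQuiver D)) :
    coeff ⟨_, _, (cutIncl D).mapPath p⟩ (cutInclAlgHom k D x) = coeff ⟨i, j, p⟩ x := by
  induction x using PathAlgebra.induction_on with
  | zero => simp
  | add x x' h h' => rw [map_add, map_add, map_add, h, h']
  | smul c x h => rw [map_smul, map_smul, map_smul, h]
  | @path i' j' q =>
  rw [cutInclAlgHom_ofPath]
  by_cases hqp : (⟨i', j', q⟩ : QuiverPath (CutQuiver D)) = ⟨i, j, p⟩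
  · cases hqp
    rw [coeff_ofPath_self, coeff_ofPath_self]
  · rw [coeff_ofPath_of_ne _ hqp, coeff_ofPath_of_ne]
    exact fun h => hqp (mapPath_injective q p h)

/-- The ideal of relations between the arrows that are not deleted. -/
noncomputable def gentleIdeal (k : Type w) [Field k] (D : Set Γ.Arrow) :
    TwoSidedIdeal (PathAlgebra k (CutQuiver D)) :=
  (Γ.cutIdeal k D).comap (cutInclAlgHom k D)

theorem mem_gentleIdeal {x : PathAlgebra k (CutQuiver D)} :
    x ∈ gentleIdeal k D ↔ cutInclAlgHom k D x ∈ Γ.cutIdeal k D :=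
  TwoSidedIdeal.mem_comap _

/-- The paths of length two that do not follow a vertex cycle. -/
def turns (D : Set Γ.Arrow) : Set (QuiverPath (CutQuiver D)) :=
  {p | ∃ (i j l : CutQuiver D) (f : i ⟶ j) (g : j ⟶ l), Γ.next (cutGerm f) ≠ cutGerm g ∧
    p = ⟨i, l, f.toPath.comp g.toPath⟩}

/-- The ideal generated by the paths of length two that do not follow a vertex cycle. -/
noncomputable def turnIdeal (k : Type w) [Field k] (D : Set Γ.Arrow) :
    TwoSidedIdeal (PathAlgebra k (CutQuiver D)) :=
  TwoSidedIdeal.span ((fun p : QuiverPath (CutQuiver D) => ofPath k p.2.2) '' turns D)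

theorem ofArrow_mul_ofArrow_mem_turnIdeal {i j l : CutQuiver D} (f : i ⟶ j) (g : j ⟶ l)
    (h : Γ.next (cutGerm f) ≠ cutGerm g) : ofArrow k f * ofArrow k g ∈ turnIdeal k D :=
  TwoSidedIdeal.subset_span ⟨_, ⟨i, j, l, f, g, h, rfl⟩, (ofPath_mul_ofPath k _ _).symm⟩

theorem turnIdeal_le_gentleIdeal : turnIdeal k D ≤ gentleIdeal k D := by
  refine TwoSidedIdeal.span_le.2 ?_
  rintro _ ⟨_, ⟨i, j, l, f, g, h, rfl⟩, rfl⟩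
  rw [SetLike.mem_coe, mem_gentleIdeal]
  change cutInclAlgHom k D (ofPath k (f.toPath.comp g.toPath)) ∈ _
  rw [← ofPath_mul_ofPath, map_mul]
  change cutInclAlgHom k D (ofArrow k f) * cutInclAlgHom k D (ofArrow k g) ∈ _
  rw [cutInclAlgHom_ofArrow, cutInclAlgHom_ofArrow]
  exact ideal_le_cutIdeal k D (ofArrow_mul_ofArrow_mem_ideal _ _ h)

/-- A full path would contain an arrow of `D`, so of the three outcomes of `Extendable.cons` only
extension and a turn remain. -/
theorem extendable_or_mem_turnIdeal (hD : Γ.IsCuttingSet D) (hmult : ∀ x, Γ.mult x = 1)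
    (σ : Γ.QuiverVertex → Γ.Arrow) (hσ : ∀ i, (σ i).src = i) {i j : CutQuiver D}
    (p : Quiver.Path i j) :
    Extendable ((cutIncl D).mapPath p) ∨ ofPath k p ∈ turnIdeal k D := by
  induction p with
  | nil => exact Or.inl (extendable_nil hmult (σ i) (hσ i))
  | @cons j l p f ih =>
    obtain h | h := ih
    · obtain h | h | ⟨j', p', g, hp, hg⟩ := h.cons hmult ((cutIncl D).map f)
      · exact Or.inl h
      · obtain ⟨g, hg, hc⟩ := hD.exists_isCut hmult h
        exact absurd hc (cutFree_mapPath (p.cons f) g hg)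
      · cases p with
        | nil => cases hp
        | cons p e =>
          cases hp
          refine Or.inr ?_
          rw [ofPath_cons, ofPath_cons, mul_assoc]
          exact TwoSidedIdeal.mul_mem_left _ _ _ (ofArrow_mul_ofArrow_mem_turnIdeal e f hg)
    · refine Or.inr ?_
      rw [ofPath_cons]
      exact TwoSidedIdeal.mul_mem_right _ _ _ h

/-- The coefficient of an extendable path is a trace against an element of the radical, so it is
zero. -/
theorem not_extendable_of_mem_gentleIdeal (hD : Γ.IsCuttingSet D) (hmult : ∀ x, Γ.mult x = 1)
    {x : PathAlgebra k (CutQuiver D)} (hx : x ∈ gentleIdeal k D) {i j : CutQuiver D}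
    {p : Quiver.Path i j} (hp : coeff ⟨i, j, p⟩ x ≠ 0) :
    ¬ Extendable ((cutIncl D).mapPath p) := by
  intro h
  obtain ⟨y, hy⟩ := h.exists_trace_mul_eq_coeff (k := k)
  have h1 := (mem_cutIdeal_iff hD hmult).1 (mem_gentleIdeal.1 hx)
  rw [cutFreePart_cutInclAlgHom] at h1
  rw [← coeff_cutInclAlgHom, ← hy, trace_mul_eq_zero_of_mem_ideal hmult h1] at hp
  exact hp rfl

theorem gentleIdeal_eq_turnIdeal (hD : Γ.IsCuttingSet D) (hmult : ∀ x, Γ.mult x = 1)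
    (σ : Γ.QuiverVertex → Γ.Arrow) (hσ : ∀ i, (σ i).src = i) :
    gentleIdeal k D = turnIdeal k D := by
  refine le_antisymm (fun x hx => ?_) turnIdeal_le_gentleIdeal
  suffices h : x ∈ idealSubmodule (turnIdeal k D) from h
  exact mem_of_forall_coeff fun p hp =>
    (extendable_or_mem_turnIdeal hD hmult σ hσ p).resolve_left
      (not_extendable_of_mem_gentleIdeal hD hmult hx hp)

theorem isAdmissibleIdeal_gentleIdeal [Nonempty E] (hD : Γ.IsCuttingSet D)
    (hmult : ∀ x, Γ.mult x = 1) (σ : Γ.QuiverVertex → Γ.Arrow) (hσ : ∀ i, (σ i).src = i) :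
    IsAdmissibleIdeal (gentleIdeal k D) := by
  classical
  refine ⟨fun x hx => mem_of_forall_coeff fun {i j} p hp => ?_,
    -- A path of this length repeats a germ, so it is not extendable.
    Fintype.card (E × Bool) + 1, Nat.succ_le_succ Fintype.card_pos, fun x hx => ?_⟩
  · have h := not_extendable_of_mem_gentleIdeal hD hmult hx hp
    refine Submodule.subset_span ⟨i, j, p, ?_, rfl⟩
    cases p with
    | nil => exact absurd (extendable_nil hmult (σ i) (hσ i)) h
    | cons p f =>
      cases p with
      | nil => exact absurd (extendable_toPath hmult ((cutIncl D).map f)) h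
      | cons p g => simp
  · suffices h : lengthGE k (CutQuiver D) (Fintype.card (E × Bool) + 1) ≤
      idealSubmodule (gentleIdeal k D) from h hx
    refine Submodule.span_le.2 ?_
    rintro _ ⟨i, j, p, hp, rfl⟩
    refine turnIdeal_le_gentleIdeal
      ((extendable_or_mem_turnIdeal hD hmult σ hσ p).resolve_left ?_)
    rintro ⟨q, -, h⟩
    have h1 := (List.nodup_append.1 h.nodup).2.1.length_le_card
    rw [germs_mapPath, Quiver.Path.length_labels] at h1
    omega

theorem ofArrow_mul_ofArrow_mem_gentleIdeal_iff (hD : Γ.IsCuttingSet D)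
    (hmult : ∀ x, Γ.mult x = 1) {i j l : CutQuiver D} (f : i ⟶ j) (g : j ⟶ l) :
    ofArrow k f * ofArrow k g ∈ gentleIdeal k D ↔ Γ.next (cutGerm f) ≠ cutGerm g := by
  refine ⟨fun h hfg => ?_, fun h =>
    turnIdeal_le_gentleIdeal (ofArrow_mul_ofArrow_mem_turnIdeal f g h)⟩
  have h1 : ofArrow k f * ofArrow k g = ofPath k (f.toPath.cons g) :=
    (ofPath_cons f.toPath g).symm
  rw [h1] at h
  refine not_extendable_of_mem_gentleIdeal hD hmult h
    (by rw [coeff_ofPath_self]; exact one_ne_zero) ?_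
  obtain h | h | ⟨j', p', e, hp, he⟩ :=
    (extendable_toPath hmult ((cutIncl D).map f)).cons hmult ((cutIncl D).map g)
  · exact h
  · obtain ⟨e, he, hc⟩ := hD.exists_isCut hmult h
    exact absurd hc (cutFree_mapPath (f.toPath.cons g) e he)
  · cases hp
    exact absurd hfg he

/-- An arrow is determined by its germ, and also by the successor of that germ; with two germs at
each edge this gives (S1). A nonzero continuation is the successor, which gives (S2); a zero one is
the other germ of the same edge, which gives (S4). -/
theorem isGentlePair_gentleIdeal (hD : Γ.IsCuttingSet D) (hmult : ∀ x, Γ.mult x = 1)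
    (σ : Γ.QuiverVertex → Γ.Arrow) (hσ : ∀ i, (σ i).src = i) :
    IsGentlePair (gentleIdeal k D) where
  card_out_le i := by
    rw [← Fintype.card_bool, ← Nat.card_eq_fintype_card]
    refine Nat.card_le_card_of_injective (fun f : Σ j, (i ⟶ j) => (cutGerm f.2).2) ?_
    rintro ⟨j, f⟩ ⟨j', f'⟩ h
    exact sigma_target_eq f f' (Prod.ext ((cutGerm_fst f).trans (cutGerm_fst f').symm) h)
  card_in_le j := by
    rw [← Fintype.card_bool, ← Nat.card_eq_fintype_card]
    refine Nat.card_le_card_of_injective (fun f : Σ i, (i ⟶ j) => (Γ.next (cutGerm f.2)).2) ?_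
    rintro ⟨i, f⟩ ⟨i', f'⟩ h
    exact sigma_source_eq f f' (Γ.next.injective
      (Prod.ext ((next_cutGerm_fst f).trans (next_cutGerm_fst f').symm) h))
  unique_notMem_right f g g' h h' := by
    rw [ofArrow_mul_ofArrow_mem_gentleIdeal_iff hD hmult, not_not] at h h'
    exact sigma_target_eq g.2 g'.2 (h.symm.trans h')
  unique_notMem_left f g g' h h' := by
    rw [ofArrow_mul_ofArrow_mem_gentleIdeal_iff hD hmult, not_not] at h h'
    exact sigma_source_eq g.2 g'.2 (Γ.next.injective (h.trans h'.symm))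
  generated := by
    refine ⟨turns D, ?_, gentleIdeal_eq_turnIdeal hD hmult σ hσ⟩
    rintro _ ⟨i, j, l, f, g, -, rfl⟩
    rfl
  unique_mem_right f g g' h h' := by
    rw [ofArrow_mul_ofArrow_mem_gentleIdeal_iff hD hmult] at h h'
    have key : ∀ {l} (g : _ ⟶ l), Γ.next (cutGerm f) ≠ cutGerm g →
        cutGerm g = otherGerm (Γ.next (cutGerm f)) := fun g h =>
      eq_otherGerm ((cutGerm_fst g).trans (next_cutGerm_fst f).symm) h.symm
    exact sigma_target_eq g.2 g'.2 ((key _ h).trans (key _ h').symm)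
  unique_mem_left f g g' h h' := by
    rw [ofArrow_mul_ofArrow_mem_gentleIdeal_iff hD hmult] at h h'
    have key : ∀ {l} (g : l ⟶ _), Γ.next (cutGerm g) ≠ cutGerm f →
        Γ.next (cutGerm g) = otherGerm (cutGerm f) := fun g h =>
      eq_otherGerm ((next_cutGerm_fst g).trans (cutGerm_fst f).symm) h
    exact sigma_source_eq g.2 g'.2 (Γ.next.injective ((key _ h).trans (key _ h').symm))

theorem mkₐ_cutInclAlgHom_surjective (k : Type w) [Field k] (D : Set Γ.Arrow) :
    Function.Surjective
      ((Ideal.Quotient.mkₐ k (Γ.cutIdeal k D).asIdeal).comp (cutInclAlgHom k D)) := by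
  intro x
  obtain ⟨x, rfl⟩ := Ideal.Quotient.mkₐ_surjective k (Γ.cutIdeal k D).asIdeal x
  suffices h : x ∈ (LinearMap.range ((Ideal.Quotient.mkₐ k (Γ.cutIdeal k D).asIdeal).comp
      (cutInclAlgHom k D)).toLinearMap).comap
      (Ideal.Quotient.mkₐ k (Γ.cutIdeal k D).asIdeal).toLinearMap from h
  refine mem_of_forall_coeff fun {i j} p _ => ?_
  by_cases hp : CutFree D p
  · obtain ⟨j', p', h⟩ := CutFree.exists_mapPath_eq (i := i) p hp
    exact ⟨ofPath k p', (congrArg (Ideal.Quotient.mkₐ k (Γ.cutIdeal k D).asIdeal)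
      (cutInclAlgHom_ofPath p')).trans (congrArg (fun p : QuiverPath Γ.QuiverVertex =>
        Ideal.Quotient.mkₐ k (Γ.cutIdeal k D).asIdeal (ofPath k p.2.2)) h)⟩
  · refine ⟨0, ?_⟩
    rw [map_zero]
    exact (Ideal.Quotient.eq_zero_iff_mem.2 (ofPath_mem_cutIdeal hp)).symm

/-- An admissible cut is the path algebra of the quiver without the deleted arrows, modulo the
remaining relations. -/
noncomputable def admissibleCutEquiv (k : Type w) [Field k] (D : Set Γ.Arrow) :
    Γ.admissibleCut k D ≃ₐ[k] QuotientAlgebra (gentleIdeal k D) :=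
  ((Ideal.quotientEquivAlgOfEq k (Ideal.ext fun x => by
      rw [RingHom.mem_ker, TwoSidedIdeal.mem_asIdeal, mem_gentleIdeal]
      exact (Ideal.Quotient.eq_zero_iff_mem (I := (Γ.cutIdeal k D).asIdeal)).symm)).trans
    (Ideal.quotientKerAlgEquivOfSurjective (mkₐ_cutInclAlgHom_surjective k D))).symm

end Algebra

/-! ### Connectedness after cutting, and arrows at every edge. -/

section Connected

variable [Finite E]

/-- Removing one arrow from an oriented cycle leaves a path through all of its edges, starting just
after the removed arrow `α`. -/
theorem eqvGen_of_endpoint_eq (hD : Γ.IsCuttingSet D) (hmult : ∀ x, Γ.mult x = 1)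
    {g g' : E × Bool} (h : Γ.endpoint g = Γ.endpoint g') :
    Relation.EqvGen (fun i j : CutQuiver D => Nonempty (i ⟶ j)) g.1 g'.1 := by
  by_cases hg : Γ.Truncated g
  · rw [((sameCycle_iff.2 h).eq_of_left ((truncated_iff hmult g).1 hg))]
    exact .refl _
  · obtain ⟨α, ⟨hα, hv⟩, huniq⟩ := hD (Γ.endpoint g) ⟨⟨g, hg⟩, rfl⟩
    have key : ∀ n : ℕ, Relation.EqvGen (fun i j : CutQuiver D => Nonempty (i ⟶ j))
        (Γ.next α.1).1 ((Γ.next ^ n) (Γ.next α.1)).1 := by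
      intro n
      induction n with
      | zero => exact .refl _
      | succ n ih =>
        rw [pow_succ', Equiv.Perm.mul_apply]
        set x := (Γ.next ^ n) (Γ.next α.1) with hx
        -- The only missing step is the one out of `α`, and it leads back to the starting point.
        by_cases hxα : x = α.1
        · rw [hxα]
          exact .refl _
        · have hend : Γ.endpoint x = Γ.endpoint g := by
            have h1 : Γ.next.SameCycle (Γ.next α.1) x := ⟨n, by simp [hx]⟩
            rw [← sameCycle_iff.1 h1, Γ.endpoint_next]
            exact hv
          have hxt : ¬ Γ.Truncated x := by
            unfold Truncated at hg ⊢
            rwa [hend]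
          refine .trans _ _ _ ih (.rel _ _ ⟨⟨x, ⟨hxt, fun hd => hxα ?_⟩, rfl, rfl⟩⟩)
          exact congrArg Subtype.val (huniq ⟨x, hxt⟩ ⟨hd, hend⟩)
    have key' : ∀ x, Γ.endpoint x = Γ.endpoint g →
        Relation.EqvGen (fun i j : CutQuiver D => Nonempty (i ⟶ j)) (Γ.next α.1).1 x.1 := by
      intro x hx
      have h1 : Γ.next.SameCycle (Γ.next α.1) x := by
        rw [sameCycle_iff, Γ.endpoint_next, hx]
        exact hv
      obtain ⟨n, rfl⟩ := h1.exists_nat_pow_eq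
      exact key n
    exact .trans _ _ _ (.symm _ _ (key' g rfl)) (key' g' h.symm)

theorem quiverConnected_cutQuiver [Nonempty E] (hD : Γ.IsCuttingSet D)
    (hmult : ∀ x, Γ.mult x = 1) : QuiverConnected (CutQuiver D) := by
  refine ⟨inferInstanceAs (Nonempty E), fun a b => ?_⟩
  -- The first component is needed for transitivity: it provides a germ at the intermediate vertex.
  suffices h : ∀ x y : V, ((∃ g, Γ.endpoint g = x) ↔ ∃ g, Γ.endpoint g = y) ∧
      ∀ g g', Γ.endpoint g = x → Γ.endpoint g' = y →
        Relation.EqvGen (fun i j : CutQuiver D => Nonempty (i ⟶ j)) g.1 g'.1 from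
    (h (Γ.endpoint (a, false)) (Γ.endpoint (b, false))).2 (a, false) (b, false) rfl rfl
  intro x y
  induction Γ.connected x y with
  | rel x y h =>
    obtain ⟨e, rfl, rfl⟩ := h
    refine ⟨⟨fun _ => ⟨_, rfl⟩, fun _ => ⟨_, rfl⟩⟩, fun g g' hg hg' => ?_⟩
    exact .trans _ _ _ (eqvGen_of_endpoint_eq hD hmult hg)
      (eqvGen_of_endpoint_eq (g := (e, true)) hD hmult hg'.symm)
  | refl x =>
    exact ⟨Iff.rfl, fun g g' hg hg' => eqvGen_of_endpoint_eq hD hmult (hg.trans hg'.symm)⟩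
  | symm x y _ ih => exact ⟨ih.1.symm, fun g g' hg hg' => .symm _ _ (ih.2 g' g hg' hg)⟩
  | trans x y z _ _ ih ih' =>
    refine ⟨ih.1.trans ih'.1, fun g g' hg hg' => ?_⟩
    obtain ⟨m, hm⟩ := ih.1.1 ⟨g, hg⟩
    exact .trans _ _ _ (ih.2 g m hg hm) (ih'.2 m g' hm hg')

end Connected

/-- If no arrow starts at `i`, each germ of `i` is alone at its vertex. By connectedness these two
distinct vertices are all of `V`, and `i` is the only edge, which is the excluded graph. -/
theorem exists_arrow_src_eq [Fintype V] [Fintype E] (hmult : ∀ x, Γ.mult x = 1)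
    (hΓ : ¬ (Fintype.card E = 1 ∧ Fintype.card V = 2)) (i : Γ.QuiverVertex) :
    ∃ α : Γ.Arrow, α.src = i := by
  classical
  by_contra hcon
  have htrunc : ∀ b : Bool, Γ.next (i, b) = (i, b) := fun b => by
    by_contra h
    exact hcon ⟨⟨(i, b), fun h' => h ((truncated_iff hmult _).1 h')⟩, rfl⟩
  have huniq : ∀ (b : Bool) (g : E × Bool), Γ.endpoint g = Γ.endpoint (i, b) → g = (i, b) :=
    fun b g hg => (sameCycle_iff.2 hg).eq_of_right (htrunc b)
  have hV : ∀ x y : V, (∃ b, Γ.endpoint (i, b) = x) ↔ ∃ b, Γ.endpoint (i, b) = y := by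
    intro x y
    induction Γ.connected x y with
    | rel x y h =>
      obtain ⟨e, rfl, rfl⟩ := h
      constructor
      · rintro ⟨b, hb⟩
        have h1 : e = i := congrArg Prod.fst (huniq b (e, false) hb.symm)
        exact ⟨true, by rw [h1]⟩
      · rintro ⟨b, hb⟩
        have h1 : e = i := congrArg Prod.fst (huniq b (e, true) hb.symm)
        exact ⟨false, by rw [h1]⟩
    | refl x => exact Iff.rfl
    | symm x y _ ih => exact ih.symm
    | trans x y z _ _ ih ih' => exact ih.trans ih'
  have hV' : ∀ x, ∃ b, Γ.endpoint (i, b) = x := fun x => (hV _ x).1 ⟨true, rfl⟩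
  refine hΓ ⟨Fintype.card_eq_one_iff.2 ⟨i, fun e => ?_⟩, ?_⟩
  · obtain ⟨b, hb⟩ := hV' (Γ.endpoint (e, true))
    exact congrArg Prod.fst (huniq b (e, true) hb.symm)
  · rw [← Fintype.card_bool]
    refine (Fintype.card_of_bijective (f := fun b => Γ.endpoint (i, b)) ⟨fun b b' h => ?_, hV'⟩).symm
    exact congrArg Prod.snd (huniq b' (i, b) h)

end BrauerGraph

theorem theorem1p3 {k : Type w} [Field k] [IsAlgClosed k]
    {V : Type v} {E : Type u} [Fintype V] [Fintype E] [Nonempty E]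
    (Γ : BrauerGraph V E) (hmult : ∀ x, Γ.mult x = 1)
    (hΓ : ¬ (Fintype.card E = 1 ∧ Fintype.card V = 2))
    (D : Set Γ.Arrow) (hD : Γ.IsCuttingSet D) :
    IsGentle.{u} k (Γ.admissibleCut k D) ∧
      Nonempty (TrivialExtension k (Γ.admissibleCut k D) ≃ₐ[k] Γ.algebra k) := by
  choose σ hσ using BrauerGraph.exists_arrow_src_eq hmult hΓ
  refine ⟨⟨BrauerGraph.finite_quotient hmult σ hσ (BrauerGraph.ideal_le_cutIdeal k D),
    BrauerGraph.CutQuiver D, inferInstance, inferInstance, inferInstance,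
    BrauerGraph.gentleIdeal k D, BrauerGraph.quiverConnected_cutQuiver hD hmult,
    BrauerGraph.isAdmissibleIdeal_gentleIdeal hD hmult σ hσ,
    BrauerGraph.isGentlePair_gentleIdeal hD hmult σ hσ,
    IsMoritaEquivalent.of_algEquiv k (BrauerGraph.admissibleCutEquiv k D)⟩, ⟨?_⟩⟩
  exact BrauerGraph.trivialExtensionEquiv k hD hmult σ hσ
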